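/- For a partition $\lambda$ of $n$ let $\chi_\lambda$ be the irreducible complex character of the symmetric group $\mathfrak S_n$ indexed by $\lambda$ (the character of the Specht module $S^\lambda$), and for $0\le j\le\lfloor n/2\rfloor$ let $\chi_\lambda(j)$ be its value at a permutation of cycle type $2^j1^{n-2j}$. For integers $n\ge 0$, $0\le k\le\lfloor n/2\rfloor$ and $0\le i\le\lfloor n/2\rfloor$ define $\alpha_{n,k,i}$ by $$2^i\,\alpha_{n,k,i}=\sum_{j=0}^{i}\binom ij\,\chi_{(n-k,k)}(j),$$ and set $\alpha_{n,k,i}=0$ if $k<0$, $k>\lfloor n/2\rfloor$ or $i>\lfloor n/2\rfloor$. Then for all integers $\ell\ge 0$ and $0\le k,i\le \ell$, $$\alpha_{2\ell,k,i}=\sum_{t=0}^{\ell-i}\binom{\ell-i}{t}\,\alpha_{2\ell-2t,\;k-t,\;\ell-t}.$$ Moreover, let $C_\ell$ be the $\ell$-th Catalan number, and let $R_\ell$ be the $\ell$-th Riordan number, that is, the number of lattice paths from $(0,0)$ to $(\ell,0)$ with steps $U=(1,1)$, $H=(1,0)$ and $D=(1,-1)$ that never go below the horizontal axis and have no $H$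 step at height $0$. Then, for all $\ell\ge 0$, $\alpha_{2\ell,\ell,0}=C_\ell$ and $\alpha_{2\ell,\ell,\ell}=R_\ell$, so that the case $k=\ell$, $i=0$ of the identity above reads $$C_\ell=\sum_{t=0}^{\ell}\binom{\ell}{t}R_{\ell-t}.$$ -/

import Mathlib

open scoped MonoidAlgebra

namespace TwoRowImmanant

/-! ### Specht modules and irreducible characters of the symmetric group -/

/-- A Young tableau of shape `μ` with entries the elements of `Fin n`, each used once: the
bijection sending an entry to the cell which contains it.  There are such tableaux only if `μ` has
`n` cells. -/
abbrev Tableau (n : ℕ) (μ : YoungDiagram) : Type := Fin n ≃ {c : ℕ × ℕ // c ∈ μ.cells}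

namespace Tableau

variable {n : ℕ} {μ : YoungDiagram}

/-- The (zero-based) row of `t` that contains the entry `x`. -/
def row (t : Tableau n μ) (x : Fin n) : ℕ := (t x).1.1

/-- The (zero-based) column of `t` that contains the entry `x`. -/
def col (t : Tableau n μ) (x : Fin n) : ℕ := (t x).1.2

/-- `t.permute σ` is the tableau `σ t`, in which every entry `x` of `t` is replaced by `σ x`. -/
def permute (σ : Equiv.Perm (Fin n)) (t : Tableau n μ) : Tableau n μ := σ.symm.trans t

/-- The column stabilizer of `t`: the permutations that keep every entry in its column. -/
def columnStabilizer (t : Tableau n μ) : Finset (Equiv.Perm (Fin n)) :=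
  Finset.univ.filter fun σ => ∀ x, t.col (σ x) = t.col x

end Tableau

/-- A tabloid of shape `μ`, i.e. a row-equivalence class of tableaux of shape `μ`, given by the
function that tells in which row each entry lies: row `i` has to receive `μ.rowLen i` entries. -/
abbrev Tabloid (n : ℕ) (μ : YoungDiagram) : Type :=
  {r : Fin n → ℕ // ∀ i, (Finset.univ.filter fun x => r x = i).card = μ.rowLen i}

/-- The symmetric group acts on tabloids by permuting entries. -/
instance Tabloid.mulAction (n : ℕ) (μ : YoungDiagram) :
    MulAction (Equiv.Perm (Fin n)) (Tabloid n μ) where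
  smul σ T := ⟨fun x => T.1 (σ⁻¹ x), fun i => by
    rw [← T.2 i]
    exact Finset.card_bij (fun x _ => σ⁻¹ x) (by simp) (by simp)
      (fun y hy => ⟨σ y, by simpa using hy, by simp⟩)⟩
  one_smul T := rfl
  mul_smul σ τ T := by
    apply Subtype.ext
    funext x
    change T.1 ((σ * τ)⁻¹ x) = T.1 (τ⁻¹ (σ⁻¹ x))
    simp [mul_inv_rev]

/-- The tabloid `{t}` of a tableau `t`. -/
def Tableau.tabloid {n : ℕ} {μ : YoungDiagram} (t : Tableau n μ) : Tabloid n μ :=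
  ⟨t.row, fun i => by
    rw [YoungDiagram.rowLen_eq_card]
    refine Finset.card_bij (fun x _ => (t x).1) ?_ ?_ ?_
    · intro x hx
      rw [YoungDiagram.row, Finset.mem_filter]
      exact ⟨(t x).2, (Finset.mem_filter.1 hx).2⟩
    · intro x _ y _ h
      exact t.injective (Subtype.ext h)
    · intro c hc
      rw [YoungDiagram.row, Finset.mem_filter] at hc
      refine ⟨t.symm ⟨c, hc.1⟩, Finset.mem_filter.2 ⟨Finset.mem_univ _, ?_⟩, by simp⟩
      simpa only [Tableau.row, Equiv.apply_symm_apply] using hc.2⟩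

theorem Tableau.smul_tabloid {n : ℕ} {μ : YoungDiagram} (σ : Equiv.Perm (Fin n))
    (t : Tableau n μ) : σ • t.tabloid = (t.permute σ).tabloid := rfl

/-- The permutation module `M^μ`: the complex vector space with basis the tabloids of shape `μ`,
with the action of the symmetric group that permutes this basis. -/
noncomputable abbrev permutationModule (n : ℕ) (μ : YoungDiagram) :
    Representation ℂ (Equiv.Perm (Fin n)) ℂ[Tabloid n μ] :=
  Representation.ofMulAction ℂ (Equiv.Perm (Fin n)) (Tabloid n μ)

/-- The polytabloid `e_t = ∑ sgn(σ) {σ t}`, where `σ` runs over the column stabilizer of `t`. -/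
noncomputable def polytabloid {n : ℕ} {μ : YoungDiagram} (t : Tableau n μ) : ℂ[Tabloid n μ] :=
  ∑ σ ∈ t.columnStabilizer,
    MonoidAlgebra.single (t.permute σ).tabloid (((Equiv.Perm.sign σ : ℤˣ) : ℤ) : ℂ)

theorem permutationModule_polytabloid {n : ℕ} {μ : YoungDiagram} (g : Equiv.Perm (Fin n))
    (t : Tableau n μ) :
    permutationModule n μ g (polytabloid t) = polytabloid (t.permute g) := by
  rw [polytabloid, polytabloid, map_sum]
  refine Finset.sum_bij (fun σ _ => g * σ * g⁻¹) ?_ ?_ ?_ ?_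
  · intro σ hσ
    simp only [Tableau.columnStabilizer, Finset.mem_filter, Finset.mem_univ, true_and] at hσ ⊢
    intro x
    have h := hσ (g⁻¹ x)
    simpa [Tableau.col, Tableau.permute, Equiv.Perm.inv_def] using h
  · intro σ _ τ _ h
    simpa using h
  · intro τ hτ
    refine ⟨g⁻¹ * τ * g, ?_, by group⟩
    simp only [Tableau.columnStabilizer, Finset.mem_filter, Finset.mem_univ, true_and] at hτ ⊢
    intro x
    have h := hτ (g x)
    simpa [Tableau.col, Tableau.permute, Equiv.Perm.inv_def] using h
  · intro σ _
    rw [Representation.ofMulAction_single, Tableau.smul_tabloid]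
    have h1 : (t.permute σ).permute g = (t.permute g).permute (g * σ * g⁻¹) := by
      refine Equiv.ext fun x => ?_
      simp [Tableau.permute, Equiv.Perm.mul_def, Equiv.Perm.inv_def]
    have h2 : Equiv.Perm.sign (g * σ * g⁻¹) = Equiv.Perm.sign σ := by
      rw [map_mul, map_mul, map_inv, mul_comm, inv_mul_cancel_left]
    rw [h1, h2]

/-- The Specht module `S^μ`: the subrepresentation of `M^μ` spanned by the polytabloids.  For `μ`
with `n` cells, this is the irreducible complex representation of the symmetric group on `n`
letters that is indexed by the partition `μ`. -/
noncomputable def specht (n : ℕ) (μ : YoungDiagram) :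
    Subrepresentation (permutationModule n μ) where
  toSubmodule := Submodule.span ℂ (Set.range (polytabloid (n := n) (μ := μ)))
  apply_mem_toSubmodule g v hv := by
    induction hv using Submodule.span_induction with
    | mem v hv =>
      obtain ⟨t, rfl⟩ := hv
      rw [permutationModule_polytabloid]
      exact Submodule.subset_span ⟨_, rfl⟩
    | zero => rw [map_zero]; exact Submodule.zero_mem _
    | add v w _ _ hv hw => rw [map_add]; exact Submodule.add_mem _ hv hw
    | smul a v _ hv => rw [map_smul]; exact Submodule.smul_mem _ a hv

/-- The irreducible character `χ_μ` of the symmetric group on `n` letters. -/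
noncomputable def irreducibleCharacter (n : ℕ) (μ : YoungDiagram) (σ : Equiv.Perm (Fin n)) : ℂ :=
  (specht n μ).toRepresentation.character σ

open Classical in
/-- `χ_μ(j)`: the value of `χ_μ` at a permutation of cycle type `2^j 1^(n-2j)`, where `2 j ≤ n`.
(`Equiv.Perm.cycleType` does not list fixed points.) -/
noncomputable def characterAt (n : ℕ) (μ : YoungDiagram) (j : ℕ) : ℂ :=
  if h : ∃ σ : Equiv.Perm (Fin n), σ.cycleType = Multiset.replicate j 2 then
    irreducibleCharacter n μ h.choose
  else 0

/-! ### The numbers `α` -/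

/-- `α_{n,μ,i}`, defined by `2^i α_{n,μ,i} = ∑_{j=0}^{i} C(i,j) χ_μ(j)`. -/
noncomputable def shapeAlpha (n : ℕ) (μ : YoungDiagram) (i : ℕ) : ℂ :=
  (∑ j ∈ Finset.range (i + 1), (i.choose j : ℂ) * characterAt n μ j) / 2 ^ i

/-- The Young diagram of the partition `(n - k, k)` of `n`, where `2 k ≤ n`. -/
def twoRow (n k : ℕ) (h : 2 * k ≤ n) : YoungDiagram :=
  YoungDiagram.ofRowLens [n - k, k] (by
    rw [List.sortedGE_iff_pairwise]
    simp
    omega)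

/-- `α_{n,k,i}`, which is `α_{n,μ,i}` for `μ = (n - k, k)`, and which is zero, by convention, if
`k < 0`, `k > ⌊n/2⌋` or `i > ⌊n/2⌋`. -/
noncomputable def alpha (n : ℕ) (k : ℤ) (i : ℕ) : ℂ :=
  if h : 0 ≤ k ∧ 2 * k ≤ (n : ℤ) ∧ 2 * i ≤ n then
    shapeAlpha n (twoRow n k.toNat (by omega)) i
  else 0

/-! ### Riordan numbers -/

/-- The height, after its first `m` steps, of a lattice path with `n` steps that starts at height
`0`; the steps `1`, `0`, `-1` are the up, horizontal and down steps. -/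
def pathHeight {n : ℕ} (s : Fin n → SignType) (m : ℕ) : ℤ :=
  ∑ j ∈ Finset.univ.filter (fun j : Fin n => j.val < m), (s j : ℤ)

/-- A Riordan path: a path with up, horizontal and down steps from `(0,0)` to `(n,0)` that never
goes below the horizontal axis and has no horizontal step at height `0`. -/
def IsRiordanPath {n : ℕ} (s : Fin n → SignType) : Prop :=
  pathHeight s n = 0 ∧ (∀ m ≤ n, 0 ≤ pathHeight s m) ∧
    ∀ j : Fin n, s j = 0 → pathHeight s j.val ≠ 0

/-- The Riordan number `R_n`: the number of Riordan paths from `(0,0)` to `(n,0)`. -/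
noncomputable def riordan (n : ℕ) : ℕ := Nat.card {s : Fin n → SignType // IsRiordanPath s}

end TwoRowImmanant

/-!
The generating function of the numbers `α` carries the whole statement: for `2 k ≤ n` and
`2 i ≤ n`, `alpha n k i` is the coefficient of `X ^ k` in
`(1 - X) (1 + X) ^ (n - 2 i) (1 + X + X ^ 2) ^ i` (`alpha_eq_coeff`).  For `n = 2 ℓ`, expanding
`(1 + X) ^ (2 (ℓ - i)) = (X + (1 + X + X ^ 2)) ^ (ℓ - i)` by the binomial theorem gives the
identity (`alpha_eq_sum`).

The generating function comes from the formula for the character of a two-row Specht module: its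
value at `g` is the number of `g`-invariant `k`-sets minus the number of `g`-invariant
`(k - 1)`-sets (`irreducibleCharacter_twoRow`).  To prove this, the tabloids of shape `(n - k, k)`
are identified with the `k`-sets of entries in their second row, and the permutation module with
the multilinear polynomials of degree `k` in `X_1, ..., X_n`.  A polytabloid becomes a product of
`k` disjoint differences of variables (`Tableau.coords_polytabloid`).  These products span the
kernel of the lowering operator `∑ ∂/∂X_x` in degree `k`, by induction on the number of variables
(`mem_span_pairProds`).  The lowering operator and its adjoint, the raising operator, satisfy the
commutation relation of `sl₂`; positivity of the norm then shows that `lower ∘ raise` is bijective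
below the middle degree.  Hence the polynomials of degree `k` are the sum of the Specht module and
an isomorphic copy of the polynomials of degree `k - 1` (`spechtSum_bijective`), and taking traces
gives the character.  For a permutation of cycle type `2^j 1^(n-2j)` the invariant sets have the
generating function `(1 + X) ^ (n - 2 j) (1 + X ^ 2) ^ j` (`stablePoly_eq`), and the sum that
defines `α` is evaluated by `(1 + X ^ 2) + (1 + X) ^ 2 = 2 (1 + X + X ^ 2)`.

At `k = ℓ`, `i = 0` the coefficient is `C(2ℓ, ℓ) - C(2ℓ, ℓ - 1)`, the Catalan number.  At
`k = i = ℓ` it is the middle coefficient of `(1 - X) (1 + X + X ^ 2) ^ ℓ`.  The coefficients of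
these polynomials satisfy the recurrence of the unconstrained paths with steps `1`, `0`, `-1`, and
they are antisymmetric about height `-1/2`; so the values at heights `-1` and `0` cancel in the
recurrence at height `0`, which is exactly the effect of staying nonnegative and having no
horizontal step there (`prefixCount_eq`).
-/

open scoped MonoidAlgebra

namespace TwoRowImmanant

/-! ### Lists of pairs -/

section Entries

variable {α : Type*}

/-- All the entries of the pairs of a list. -/
def entries (L : List (α × α)) : List α := L.flatMap fun p => [p.1, p.2]

@[simp] theorem entries_nil : entries ([] : List (α × α)) = [] := rfl

@[simp] theorem entries_cons (p : α × α) (L : List (α × α)) :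
    entries (p :: L) = p.1 :: p.2 :: entries L := rfl

theorem length_entries (L : List (α × α)) : (entries L).length = 2 * L.length := by
  induction L with
  | nil => rfl
  | cons p L ih => simp [ih]; ring

end Entries

/-! ### Raising and lowering operators on functions of finite sets -/

section Operators

variable {α : Type*} [DecidableEq α]

/-- The lowering operator relative to the ground set `A`: viewing `f` as the multilinear polynomial
`∑ f S ∏_{x ∈ S} X_x`, this is `∑_{x ∈ A} ∂/∂X_x`. -/
def lower (A : Finset α) : (Finset α → ℂ) →ₗ[ℂ] (Finset α → ℂ) where
  toFun f S := ∑ x ∈ A \ S, f (insert x S)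
  map_add' f g := by ext S; simp [Finset.sum_add_distrib]
  map_smul' c f := by ext S; simp [Finset.mul_sum]

/-- The raising operator: multiplication of the multilinear polynomial `∑ f S ∏_{x ∈ S} X_x` by
`∑ X_x`, where every square `X_x ^ 2` is replaced by zero. -/
def raise : (Finset α → ℂ) →ₗ[ℂ] (Finset α → ℂ) where
  toFun f S := ∑ x ∈ S, f (S.erase x)
  map_add' f g := by ext S; simp [Finset.sum_add_distrib]
  map_smul' c f := by ext S; simp [Finset.mul_sum]

theorem lower_apply (A : Finset α) (f : Finset α → ℂ) (S : Finset α) :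
    lower A f S = ∑ x ∈ A \ S, f (insert x S) := rfl

theorem raise_apply (f : Finset α → ℂ) (S : Finset α) :
    raise f S = ∑ x ∈ S, f (S.erase x) := rfl

/-- The commutation relation of the raising and lowering operators, which make the functions on
the subsets of `A` a representation of `sl₂`. -/
theorem lower_raise {A : Finset α} (f : Finset α → ℂ) {S : Finset α} (hS : S ⊆ A) :
    lower A (raise f) S =
      raise (lower A f) S + ((A.card : ℂ) - 2 * (S.card : ℂ)) * f S := by
  have h1 : lower A (raise f) S =
      ∑ x ∈ A \ S, (f S + ∑ y ∈ S, f ((insert x S).erase y)) := by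
    rw [lower_apply]
    refine Finset.sum_congr rfl fun x hx => ?_
    have hx' := (Finset.mem_sdiff.1 hx).2
    rw [raise_apply, Finset.sum_insert hx', Finset.erase_insert hx']
  have h2 : raise (lower A f) S =
      ∑ y ∈ S, (f S + ∑ x ∈ A \ S, f ((insert x S).erase y)) := by
    rw [raise_apply]
    refine Finset.sum_congr rfl fun y hy => ?_
    have e : A \ S.erase y = insert y (A \ S) := by
      ext z
      simp only [Finset.mem_sdiff, Finset.mem_erase, Finset.mem_insert]
      have := @hS z
      by_cases hz : z = y
      · subst hz; simp [hS hy]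
      · simp [hz]
    rw [lower_apply, e, Finset.sum_insert (by simp [hy]), Finset.insert_erase hy]
    congr 1
    refine Finset.sum_congr rfl fun x hx => ?_
    rw [Finset.erase_insert_of_ne]
    rintro rfl
    exact (Finset.mem_sdiff.1 hx).2 hy
  rw [h1, h2, Finset.sum_add_distrib, Finset.sum_add_distrib, Finset.sum_comm (s := S)]
  simp only [Finset.sum_const, nsmul_eq_mul]
  rw [Finset.card_sdiff_of_subset hS, Nat.cast_sub (Finset.card_le_card hS)]
  ring

/-- The lowering and the raising operator are transposes of each other. -/
theorem sum_lower_mul (A : Finset α) (f g : Finset α → ℂ) :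
    ∑ S ∈ A.powerset, lower A f S * g S = ∑ S ∈ A.powerset, f S * raise g S := by
  simp only [lower_apply, raise_apply, Finset.sum_mul, Finset.mul_sum]
  rw [Finset.sum_sigma', Finset.sum_sigma']
  refine Finset.sum_bij' (fun p _ => ⟨insert p.2 p.1, p.2⟩) (fun p _ => ⟨p.1.erase p.2, p.2⟩)
    ?_ ?_ ?_ ?_ ?_
  · rintro ⟨S, x⟩ h
    simp only [Finset.mem_sigma, Finset.mem_powerset, Finset.mem_sdiff] at h ⊢
    exact ⟨Finset.insert_subset h.2.1 h.1, Finset.mem_insert_self _ _⟩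
  · rintro ⟨S, x⟩ h
    simp only [Finset.mem_sigma, Finset.mem_powerset, Finset.mem_sdiff] at h ⊢
    exact ⟨(Finset.erase_subset _ _).trans h.1, h.1 h.2, by simp⟩
  · rintro ⟨S, x⟩ h
    simp only [Finset.mem_sigma, Finset.mem_powerset, Finset.mem_sdiff] at h
    simp [Finset.erase_insert h.2.2]
  · rintro ⟨S, x⟩ h
    simp only [Finset.mem_sigma] at h
    simp [Finset.insert_erase h.2]
  · rintro ⟨S, x⟩ h
    simp only [Finset.mem_sigma, Finset.mem_powerset, Finset.mem_sdiff] at h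
    simp [Finset.erase_insert h.2.2]

/-- The norm identity that follows from the commutation relation, as raising and lowering are
adjoint to each other. -/
theorem sum_normSq_raise (A : Finset α) (f : Finset α → ℂ) :
    ∑ S ∈ A.powerset, Complex.normSq (raise f S) =
      ∑ S ∈ A.powerset, Complex.normSq (lower A f S) +
        ∑ S ∈ A.powerset, ((A.card : ℝ) - 2 * (S.card : ℝ)) * Complex.normSq (f S) := by
  let g : Finset α → ℂ := fun S => (starRingEnd ℂ) (f S)
  have hr : ∀ S, raise g S = (starRingEnd ℂ) (raise f S) := by
    intro S; simp [raise_apply, g]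
  have hl : ∀ S, lower A g S = (starRingEnd ℂ) (lower A f S) := by
    intro S; simp [lower_apply, g]
  have key : ∑ S ∈ A.powerset, raise f S * raise g S =
      ∑ S ∈ A.powerset, lower A g S * lower A f S +
        ∑ S ∈ A.powerset, ((A.card : ℂ) - 2 * (S.card : ℂ)) * (f S * g S) := by
    rw [← sum_lower_mul, sum_lower_mul A g, ← Finset.sum_add_distrib]
    refine Finset.sum_congr rfl fun S hS => ?_
    rw [lower_raise f (Finset.mem_powerset.1 hS)]
    ring
  apply Complex.ofReal_injective
  push_cast
  simp only [← Complex.mul_conj]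
  simp only [hr, hl] at key
  rw [key]
  congr 1
  exact Finset.sum_congr rfl fun S _ => mul_comm _ _

/-- Below the middle degree the operator `lower A ∘ raise` is injective. -/
theorem eq_zero_of_lower_raise {A : Finset α} {f : Finset α → ℂ}
    (hf : ∀ S, f S ≠ 0 → S ⊆ A ∧ 2 * S.card < A.card)
    (h : ∀ S, S ⊆ A → lower A (raise f) S = 0) : f = 0 := by
  have h0 : ∑ S ∈ A.powerset, Complex.normSq (raise f S) = 0 := by
    have := sum_lower_mul A (raise f) (fun S => (starRingEnd ℂ) (f S))
    rw [Finset.sum_eq_zero (fun S hS => by rw [h S (Finset.mem_powerset.1 hS), zero_mul])] at this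
    apply Complex.ofReal_injective
    push_cast
    simp only [← Complex.mul_conj]
    rw [this]
    simp [raise_apply]
  rw [sum_normSq_raise] at h0
  have hnn : ∀ S ∈ A.powerset,
      0 ≤ ((A.card : ℝ) - 2 * (S.card : ℝ)) * Complex.normSq (f S) := by
    intro S _
    by_cases hS : f S = 0
    · simp [hS]
    · have : (2 * S.card : ℝ) < A.card := by exact_mod_cast (hf S hS).2
      exact mul_nonneg (by linarith) (Complex.normSq_nonneg _)
  have h1 : ∑ S ∈ A.powerset, ((A.card : ℝ) - 2 * (S.card : ℝ)) * Complex.normSq (f S) = 0 := by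
    have := Finset.sum_nonneg hnn
    have h2 : 0 ≤ ∑ S ∈ A.powerset, Complex.normSq (lower A f S) :=
      Finset.sum_nonneg fun _ _ => Complex.normSq_nonneg _
    linarith
  rw [Finset.sum_eq_zero_iff_of_nonneg hnn] at h1
  funext S
  by_contra hS
  have h2 := h1 S (Finset.mem_powerset.2 (hf S hS).1)
  have : (2 * S.card : ℝ) < A.card := by exact_mod_cast (hf S hS).2
  rcases mul_eq_zero.1 h2 with h3 | h3
  · linarith
  · exact hS (Complex.normSq_eq_zero.1 h3)

/-- Above the middle degree the lowering operator is injective. -/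
theorem eq_zero_of_lower {A : Finset α} {f : Finset α → ℂ}
    (hf : ∀ S, f S ≠ 0 → S ⊆ A ∧ A.card < 2 * S.card)
    (h : ∀ S, S ⊆ A → lower A f S = 0) : f = 0 := by
  have h0 := sum_normSq_raise A f
  rw [Finset.sum_eq_zero (s := A.powerset) (f := fun S => Complex.normSq (lower A f S))
    (fun S hS => by simp [h S (Finset.mem_powerset.1 hS)]), zero_add] at h0
  have hnp : ∀ S ∈ A.powerset,
      ((A.card : ℝ) - 2 * (S.card : ℝ)) * Complex.normSq (f S) ≤ 0 := by
    intro S _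
    by_cases hS : f S = 0
    · simp [hS]
    · have : (A.card : ℝ) < 2 * S.card := by exact_mod_cast (hf S hS).2
      exact mul_nonpos_of_nonpos_of_nonneg (by linarith) (Complex.normSq_nonneg _)
  have h1 : ∑ S ∈ A.powerset, ((A.card : ℝ) - 2 * (S.card : ℝ)) * Complex.normSq (f S) = 0 :=
    le_antisymm (Finset.sum_nonpos hnp)
      (h0 ▸ Finset.sum_nonneg fun _ _ => Complex.normSq_nonneg _)
  rw [Finset.sum_eq_zero_iff_of_nonpos hnp] at h1
  funext S
  by_contra hS
  have h2 := h1 S (Finset.mem_powerset.2 (hf S hS).1)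
  have : (A.card : ℝ) < 2 * S.card := by exact_mod_cast (hf S hS).2
  rcases mul_eq_zero.1 h2 with h3 | h3
  · linarith
  · exact hS (Complex.normSq_eq_zero.1 h3)

/-! ### The kernel of the lowering operator -/

/-- Multiplication of a multilinear polynomial by the variable `X_b`, where `X_b ^ 2` is replaced
by zero. -/
def mulVar (b : α) (f : Finset α → ℂ) (S : Finset α) : ℂ :=
  if b ∈ S then f (S.erase b) else 0

/-- The product of the differences `X_b - X_a` over the pairs `(a, b)` of a list, as a function on
finite sets. -/
def pairProd : List (α × α) → Finset α → ℂ
  | [] => fun S => if S = ∅ then 1 else 0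
  | p :: L => mulVar p.2 (pairProd L) - mulVar p.1 (pairProd L)

theorem support_pairProd (L : List (α × α)) {S : Finset α} (h : pairProd L S ≠ 0) :
    (∀ x ∈ S, x ∈ entries L) ∧ S.card = L.length := by
  induction L generalizing S with
  | nil =>
    have : S = ∅ := by by_contra hS; simp [pairProd, hS] at h
    simp [this]
  | cons p L ih =>
    have h' : ∃ c, (c = p.1 ∨ c = p.2) ∧ c ∈ S ∧ pairProd L (S.erase c) ≠ 0 := by
      by_contra! hc
      apply h
      have e1 := hc p.1 (Or.inl rfl)
      have e2 := hc p.2 (Or.inr rfl)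
      simp only [pairProd, mulVar, Pi.sub_apply]
      split_ifs <;> simp_all
    obtain ⟨c, hc, hcS, hne⟩ := h'
    obtain ⟨h1, h2⟩ := ih hne
    refine ⟨fun x hx => ?_, ?_⟩
    · by_cases hxc : x = c
      · subst hxc; rcases hc with rfl | rfl <;> simp
      · simp [h1 x (Finset.mem_erase.2 ⟨hxc, hx⟩)]
    · rw [List.length_cons, ← h2, Finset.card_erase_add_one hcS]

/-- The Leibniz rule for the lowering operator and the variable `X_b`, on polynomials that do not
involve `X_b`. -/
theorem lower_mulVar {A : Finset α} {b : α} (hb : b ∈ A) {f : Finset α → ℂ}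
    (hf : ∀ S, b ∈ S → f S = 0) :
    lower A (mulVar b f) = mulVar b (lower A f) + f := by
  funext S
  rw [Pi.add_apply, lower_apply]
  by_cases hS : b ∈ S
  · have e : A \ S.erase b = insert b (A \ S) := by
      ext z
      simp only [Finset.mem_sdiff, Finset.mem_erase, Finset.mem_insert]
      by_cases hz : z = b
      · subst hz; simp [hb]
      · simp [hz]
    rw [mulVar, if_pos hS, lower_apply, e, Finset.sum_insert (by simp [hS]),
      Finset.insert_erase hS, hf S hS, zero_add, add_zero]
    refine Finset.sum_congr rfl fun x hx => ?_
    rw [mulVar, if_pos (by simp [hS]), Finset.erase_insert_of_ne]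
    rintro rfl
    exact (Finset.mem_sdiff.1 hx).2 hS
  · rw [Finset.sum_eq_single b]
    · simp [mulVar, hS]
    · intro x _ hxb
      simp [mulVar, hS, Ne.symm hxb]
    · intro h
      exact absurd (Finset.mem_sdiff.2 ⟨hb, hS⟩) h

theorem mulVar_zero (b : α) : mulVar b (0 : Finset α → ℂ) = 0 := by
  funext S; simp [mulVar]

theorem lower_pairProd {A : Finset α} {L : List (α × α)} (hL : (entries L).Nodup)
    (hA : ∀ x ∈ entries L, x ∈ A) : lower A (pairProd L) = 0 := by
  induction L with
  | nil => funext S; simp [lower_apply, pairProd]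
  | cons p L ih =>
    simp only [entries_cons, List.nodup_cons, List.mem_cons, not_or] at hL
    obtain ⟨⟨h1, h2⟩, h3, h4⟩ := hL
    have hA' : ∀ x ∈ entries L, x ∈ A := fun x hx => hA x (by simp [hx])
    have hz : ∀ c, c ∉ entries L → ∀ S, c ∈ S → pairProd L S = 0 := by
      intro c hc S hS
      by_contra hne
      exact hc ((support_pairProd L hne).1 c hS)
    rw [pairProd, map_sub, lower_mulVar (hA p.2 (by simp)) (hz _ h3),
      lower_mulVar (hA p.1 (by simp)) (hz _ h2), ih h4 hA', mulVar_zero, mulVar_zero]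
    simp

/-- The products of `k` disjoint differences of variables from `A`. -/
def pairProds (A : Finset α) (k : ℕ) : Set (Finset α → ℂ) :=
  {f | ∃ L : List (α × α), (entries L).Nodup ∧ (∀ x ∈ entries L, x ∈ A) ∧ L.length = k ∧
    f = pairProd L}

theorem pairProds_mono {A B : Finset α} (h : A ⊆ B) (k : ℕ) : pairProds A k ⊆ pairProds B k := by
  rintro f ⟨L, h1, h2, h3, h4⟩
  exact ⟨L, h1, fun x hx => h (h2 x hx), h3, h4⟩

theorem lower_eq_zero_of_mem_span {A : Finset α} {k : ℕ} {f : Finset α → ℂ}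
    (hf : f ∈ Submodule.span ℂ (pairProds A k)) : lower A f = 0 := by
  have : Submodule.span ℂ (pairProds A k) ≤ LinearMap.ker (lower A) := by
    rw [Submodule.span_le]
    rintro _ ⟨L, h1, h2, -, rfl⟩
    exact lower_pairProd h1 h2
  exact this hf

theorem support_of_mem_span {A : Finset α} {k : ℕ} {f : Finset α → ℂ}
    (hf : f ∈ Submodule.span ℂ (pairProds A k)) {S : Finset α} (hS : f S ≠ 0) :
    S ⊆ A ∧ S.card = k := by
  by_contra hc
  refine hS ?_
  induction hf using Submodule.span_induction with
  | mem f hf =>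
    obtain ⟨L, -, h2, h3, rfl⟩ := hf
    by_contra hne
    have := support_pairProd L hne
    exact hc ⟨fun x hx => h2 x (this.1 x hx), this.2.trans h3⟩
  | zero => rfl
  | add f g _ _ hf hg =>
    have hf' : f S = 0 := by by_contra h; exact h (hf h)
    have hg' : g S = 0 := by by_contra h; exact h (hg h)
    simp [hf', hg']
  | smul c f _ hf =>
    have hf' : f S = 0 := by by_contra h; exact h (hf h)
    simp [hf']

/-- If there is room for one more pair, then every `g` in the span of the products of `k`
differences in `A` is the coefficient of `X_a` in some element of the span of the products of
`k + 1` differences in `insert a A`: multiply each product by `X_a - X_y`, where `X_y` is a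
variable that does not occur in it. -/
theorem exists_mem_span_insert {A : Finset α} {a : α} (ha : a ∉ A) {k : ℕ}
    (hk : 2 * k < A.card) {g : Finset α → ℂ} (hg : g ∈ Submodule.span ℂ (pairProds A k)) :
    ∃ q ∈ Submodule.span ℂ (pairProds (insert a A) (k + 1)),
      ∀ S, a ∉ S → q (insert a S) = g S := by
  induction hg using Submodule.span_induction with
  | mem g hg =>
    obtain ⟨L, h1, h2, h3, rfl⟩ := hg
    have haL : a ∉ entries L := fun h => ha (h2 a h)
    obtain ⟨y, hyA, hyL⟩ : ∃ y ∈ A, y ∉ (entries L).toFinset := by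
      apply Finset.exists_mem_notMem_of_card_lt_card
      rw [List.toFinset_card_of_nodup h1, length_entries, h3]
      exact hk
    rw [List.mem_toFinset] at hyL
    have hya : y ≠ a := by rintro rfl; exact ha hyA
    refine ⟨pairProd ((y, a) :: L), Submodule.subset_span ⟨(y, a) :: L, ?_, ?_, by simp [h3], rfl⟩,
      fun S hS => ?_⟩
    · simp [h1, haL, hyL, hya]
    · intro x hx
      simp only [entries_cons, List.mem_cons] at hx
      rcases hx with rfl | rfl | hx
      · simp [hyA]
      · simp
      · simp [h2 x hx]
    · have hz : pairProd L ((insert a S).erase y) = 0 := by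
        by_contra hne
        exact haL ((support_pairProd L hne).1 a (by simp [Ne.symm hya]))
      simp [pairProd, mulVar, hz, Finset.erase_insert hS]
  | zero => exact ⟨0, Submodule.zero_mem _, by simp⟩
  | add f g _ _ hf hg =>
    obtain ⟨q, hq, hq'⟩ := hf
    obtain ⟨r, hr, hr'⟩ := hg
    exact ⟨q + r, Submodule.add_mem _ hq hr, fun S hS => by simp [hq' S hS, hr' S hS]⟩
  | smul c f _ hf =>
    obtain ⟨q, hq, hq'⟩ := hf
    exact ⟨c • q, Submodule.smul_mem _ c hq, fun S hS => by simp [hq' S hS]⟩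

/-- The homogeneous polynomials of degree `k` killed by the lowering operator are spanned by the
products of `k` disjoint differences. -/
theorem mem_span_pairProds {A : Finset α} {k : ℕ} {f : Finset α → ℂ}
    (hf : ∀ S, f S ≠ 0 → S ⊆ A ∧ S.card = k) (h : ∀ S, S ⊆ A → lower A f S = 0) :
    f ∈ Submodule.span ℂ (pairProds A k) := by
  induction A using Finset.induction_on generalizing k f with
  | empty =>
    have : f = f ∅ • pairProd [] := by
      funext S
      by_cases hS : S = ∅
      · simp [pairProd, hS]
      · have : f S = 0 := by
          by_contra hne
          exact hS (Finset.subset_empty.1 (hf S hne).1)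
        simp [pairProd, hS, this]
    by_cases h0 : f ∅ = 0
    · rw [this, h0, zero_smul]; exact Submodule.zero_mem _
    · have hk := (hf ∅ h0).2
      rw [this]
      exact Submodule.smul_mem _ _ (Submodule.subset_span
        ⟨[], by simp, by simp, by simpa using hk, rfl⟩)
  | insert a A ha ih =>
    have hcard : (insert a A).card = A.card + 1 := Finset.card_insert_of_notMem ha
    rcases Nat.lt_or_ge (insert a A).card (2 * k) with hlt | hge
    · rw [eq_zero_of_lower (fun S hS => ⟨(hf S hS).1, by rw [(hf S hS).2]; exact hlt⟩) h]
      exact Submodule.zero_mem _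
    -- On functions supported on subsets of `A`, `lower A` and `lower (insert a A)` agree.
    have hlow : ∀ {f : Finset α → ℂ}, (∀ S, a ∈ S → f S = 0) → ∀ S, a ∉ S →
        lower (insert a A) f S = lower A f S := by
      intro f hf S hS
      rw [lower_apply, lower_apply, Finset.insert_sdiff_of_notMem _ hS,
        Finset.sum_insert (by simp [ha]), hf _ (Finset.mem_insert_self _ _), zero_add]
    have hsub : ∀ {S : Finset α}, S ⊆ insert a A → a ∉ S → S ⊆ A := fun hS haS =>
      (Finset.subset_insert_iff_of_notMem haS).1 hS
    have hmono := Submodule.span_mono (R := ℂ) (pairProds_mono (Finset.subset_insert a A) k)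
    cases k with
    | zero =>
      have hfa : ∀ S, a ∈ S → f S = 0 := by
        intro S hS
        by_contra hne
        have := (hf S hne).2
        rw [Finset.card_eq_zero] at this
        simp [this] at hS
      refine hmono (ih (fun S hS => ⟨hsub (hf S hS).1 fun haS => hS (hfa S haS), (hf S hS).2⟩) ?_)
      intro S hS
      rw [← hlow hfa S (fun h => ha (hS h))]
      exact h S (hS.trans (Finset.subset_insert a A))
    | succ k =>
      let g : Finset α → ℂ := fun S => if a ∈ S then 0 else f (insert a S)
      have hg : g ∈ Submodule.span ℂ (pairProds A k) := by
        apply ih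
        · intro S hS
          have haS : a ∉ S := fun haS => hS (by simp [g, haS])
          have hS' : f (insert a S) ≠ 0 := by simpa [g, haS] using hS
          obtain ⟨h1, h2⟩ := hf _ hS'
          rw [Finset.card_insert_of_notMem haS] at h2
          exact ⟨hsub ((Finset.subset_insert a S).trans h1) haS, by omega⟩
        · intro S hS
          have haS : a ∉ S := fun h => ha (hS h)
          have h1 := h (insert a S) (Finset.insert_subset_insert a hS)
          rw [lower_apply] at h1 ⊢
          rw [← h1]
          have e : insert a A \ insert a S = A \ S := by
            ext z
            simp only [Finset.mem_sdiff, Finset.mem_insert]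
            by_cases hz : z = a
            · subst hz; simp [ha]
            · simp [hz]
          rw [e]
          refine Finset.sum_congr rfl fun x hx => ?_
          have hxa : a ≠ x := by rintro rfl; exact ha (Finset.mem_sdiff.1 hx).1
          simp [g, haS, hxa, Finset.insert_comm a x]
      obtain ⟨q, hq, hqg⟩ := exists_mem_span_insert ha (by omega) hg
      have hfq : ∀ S, a ∈ S → (f - q) S = 0 := by
        intro S hS
        have := hqg (S.erase a) (by simp)
        rw [Finset.insert_erase hS] at this
        simp [this, g, Finset.insert_erase hS]
      have hmem : f - q ∈ Submodule.span ℂ (pairProds A (k + 1)) := by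
        apply ih
        · intro S hS
          have haS : a ∉ S := fun haS => hS (hfq S haS)
          by_cases hfS : f S = 0
          · have hqS : q S ≠ 0 := by
              intro hqS; exact hS (by simp [hfS, hqS])
            have := support_of_mem_span hq hqS
            exact ⟨hsub this.1 haS, this.2⟩
          · exact ⟨hsub (hf S hfS).1 haS, (hf S hfS).2⟩
        · intro S hS
          rw [← hlow hfq S (fun h => ha (hS h)), map_sub, lower_eq_zero_of_mem_span hq, sub_zero]
          exact h S (hS.trans (Finset.subset_insert a A))
      have := Submodule.add_mem _ (hmono hmem) hq
      simpa using this

end Operators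

/-! ### Tabloids and polytabloids of two-row shape -/

section Pairs

variable {α : Type*}

theorem getElem_entries (L : List (α × α)) (j : ℕ) (hj : j < L.length) :
    (entries L)[2 * j]? = some (L.get ⟨j, hj⟩).1 ∧
      (entries L)[2 * j + 1]? = some (L.get ⟨j, hj⟩).2 := by
  induction L generalizing j with
  | nil => simp at hj
  | cons p L ih =>
    cases j with
    | zero => simp
    | succ j =>
      have := ih j (by simpa using hj)
      simpa [mul_add] using this

/-- The restriction to sets of the right cardinality makes the coefficients of the product of the
differences multiplicative over the pairs. -/
theorem pairProd_apply [DecidableEq α] (L : List (α × α)) (hL : (entries L).Nodup)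
    (S : Finset α) :
    pairProd L S = if S.card = L.length then
      (L.map fun p => (if p.2 ∈ S then (1 : ℂ) else 0) - if p.1 ∈ S then 1 else 0).prod
      else 0 := by
  induction L generalizing S with
  | nil => simp [pairProd]
  | cons p L ih =>
    simp only [entries_cons, List.nodup_cons, List.mem_cons, not_or] at hL
    obtain ⟨⟨h1, h2⟩, h3, h4⟩ := hL
    have key : ∀ c, c ∉ entries L → mulVar c (pairProd L) S =
        (if c ∈ S then (1 : ℂ) else 0) * if S.card = L.length + 1 then
          (L.map fun p => (if p.2 ∈ S then (1 : ℂ) else 0) - if p.1 ∈ S then 1 else 0).prod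
          else 0 := by
      intro c hc
      by_cases hcS : c ∈ S
      · rw [mulVar, if_pos hcS, if_pos hcS, one_mul, ih h4, Finset.card_erase_of_mem hcS]
        have h0 : 0 < S.card := Finset.card_pos.2 ⟨c, hcS⟩
        have e : (S.card - 1 = L.length) = (S.card = L.length + 1) := by
          apply propext; omega
        have e2 : (L.map fun p => (if p.2 ∈ S.erase c then (1 : ℂ) else 0) -
            if p.1 ∈ S.erase c then 1 else 0) =
            L.map fun p => (if p.2 ∈ S then (1 : ℂ) else 0) - if p.1 ∈ S then 1 else 0 := by
          refine List.map_congr_left fun q hq => ?_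
          have m1 : q.1 ∈ entries L := List.mem_flatMap.2 ⟨q, hq, by simp⟩
          have m2 : q.2 ∈ entries L := List.mem_flatMap.2 ⟨q, hq, by simp⟩
          have n1 : q.1 ≠ c := fun h => hc (h ▸ m1)
          have n2 : q.2 ≠ c := fun h => hc (h ▸ m2)
          simp [n1, n2]
        simp only [e, e2]
      · simp [mulVar, hcS]
    rw [pairProd, Pi.sub_apply, key _ h3, key _ h2, List.length_cons, List.map_cons,
      List.prod_cons]
    split_ifs <;> ring

end Pairs

section Tabloids

variable {n k : ℕ} {h : 2 * k ≤ n}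

theorem mem_twoRow {c : ℕ × ℕ} :
    c ∈ (twoRow n k h).cells ↔ (c.1 = 0 ∧ c.2 < n - k) ∨ (c.1 = 1 ∧ c.2 < k) := by
  rw [YoungDiagram.mem_cells, twoRow, YoungDiagram.mem_ofRowLens]
  obtain ⟨i, j⟩ := c
  rcases i with _ | _ | i
  · simp
  · simp
  · simp

theorem rowLen_twoRow (i : ℕ) :
    (twoRow n k h).rowLen i = if i = 0 then n - k else if i = 1 then k else 0 := by
  have key : ∀ m, m < (twoRow n k h).rowLen i ↔
      m < if i = 0 then n - k else if i = 1 then k else 0 := by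
    intro m
    rw [← YoungDiagram.mem_iff_lt_rowLen, ← YoungDiagram.mem_cells, mem_twoRow]
    rcases i with _ | _ | i <;> simp
  exact eq_of_forall_lt_iff key

theorem card_twoRow : (twoRow n k h).cells.card = n := by
  have e : (twoRow n k h).cells =
      (Finset.range (n - k)).image (fun j => (0, j)) ∪
        (Finset.range k).image (fun j => (1, j)) := by
    ext ⟨i, j⟩
    rw [mem_twoRow]
    simp only [Finset.mem_union, Finset.mem_image, Finset.mem_range, Prod.mk.injEq]
    constructor
    · rintro (⟨rfl, h⟩ | ⟨rfl, h⟩)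
      · exact Or.inl ⟨j, h, rfl, rfl⟩
      · exact Or.inr ⟨j, h, rfl, rfl⟩
    · rintro (⟨_, h, rfl, rfl⟩ | ⟨_, h, rfl, rfl⟩)
      · exact Or.inl ⟨rfl, h⟩
      · exact Or.inr ⟨rfl, h⟩
  rw [e, Finset.card_union_of_disjoint, Finset.card_image_of_injective,
    Finset.card_image_of_injective, Finset.card_range, Finset.card_range]
  · omega
  · intro x y hxy; simpa using hxy
  · intro x y hxy; simpa using hxy
  · rw [Finset.disjoint_left]
    rintro ⟨i, j⟩ h1 h2
    simp only [Finset.mem_image, Prod.mk.injEq] at h1 h2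
    obtain ⟨_, _, rfl, _⟩ := h1
    obtain ⟨_, _, h, _⟩ := h2
    exact absurd h (by norm_num)

theorem Tabloid.row_eq (T : Tabloid n (twoRow n k h)) (x : Fin n) : T.1 x = 0 ∨ T.1 x = 1 := by
  by_contra! hc
  have h1 := T.2 (T.1 x)
  rw [rowLen_twoRow, if_neg hc.1, if_neg hc.2, Finset.card_eq_zero] at h1
  have : x ∈ (Finset.univ.filter fun y => T.1 y = T.1 x) := by simp
  simp [h1] at this

/-- The entries in the second row of a tabloid of two-row shape. -/
def Tabloid.bottom (T : Tabloid n (twoRow n k h)) : Finset (Fin n) :=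
  Finset.univ.filter fun x => T.1 x = 1

theorem Tabloid.card_bottom (T : Tabloid n (twoRow n k h)) : T.bottom.card = k := by
  rw [Tabloid.bottom, T.2 1, rowLen_twoRow]; simp

theorem Tabloid.bottom_injective :
    Function.Injective (Tabloid.bottom : Tabloid n (twoRow n k h) → Finset (Fin n)) := by
  intro T T' hT
  apply Subtype.ext
  funext x
  have h1 : x ∈ T.bottom ↔ x ∈ T'.bottom := by rw [hT]
  simp only [Tabloid.bottom, Finset.mem_filter, Finset.mem_univ, true_and] at h1
  rcases T.row_eq x with h2 | h2 <;> rcases T'.row_eq x with h3 | h3 <;> simp_all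

/-- The tabloid of two-row shape with a given second row. -/
def Tabloid.ofBottom (h : 2 * k ≤ n) (S : Finset (Fin n)) (hS : S.card = k) :
    Tabloid n (twoRow n k h) :=
  ⟨fun x => if x ∈ S then 1 else 0, fun i => by
    rw [rowLen_twoRow]
    rcases i with _ | _ | i
    · have : (Finset.univ.filter fun x => (if x ∈ S then 1 else 0) = 0) = Sᶜ := by
        ext x; simp
      rw [this, Finset.card_compl, hS]; simp
    · have : (Finset.univ.filter fun x => (if x ∈ S then 1 else 0) = 0 + 1) = S := by
        ext x; simp
      rw [this, hS]; simp
    · rw [Finset.card_eq_zero.2]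
      · simp
      · ext x
        by_cases hx : x ∈ S <;> simp [hx]⟩

@[simp] theorem Tabloid.bottom_ofBottom (S : Finset (Fin n)) (hS : S.card = k) :
    (Tabloid.ofBottom h S hS).bottom = S := by
  ext x; simp [Tabloid.bottom, Tabloid.ofBottom]

open Pointwise in
theorem Tabloid.bottom_smul (g : Equiv.Perm (Fin n)) (T : Tabloid n (twoRow n k h)) :
    (g • T).bottom = g • T.bottom := by
  ext x
  rw [← Finset.inv_smul_mem_iff]
  simp only [Tabloid.bottom, Finset.mem_filter, Finset.mem_univ, true_and]
  rfl

/-- The coordinates of a vector of the permutation module of two-row shape, as a function of the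
second row of the tabloid, extended by zero to all finite sets. -/
noncomputable def coords (h : 2 * k ≤ n) :
    ℂ[Tabloid n (twoRow n k h)] →ₗ[ℂ] (Finset (Fin n) → ℂ) where
  toFun v S := if hS : S.card = k then v.coeff (Tabloid.ofBottom h S hS) else 0
  map_add' v w := by ext S; by_cases hS : S.card = k <;> simp [hS]
  map_smul' c v := by ext S; by_cases hS : S.card = k <;> simp [hS]

theorem coords_apply (v : ℂ[Tabloid n (twoRow n k h)]) (S : Finset (Fin n)) :
    coords h v S = if hS : S.card = k then v.coeff (Tabloid.ofBottom h S hS) else 0 := rfl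

theorem coords_of_card_ne (v : ℂ[Tabloid n (twoRow n k h)]) {S : Finset (Fin n)}
    (hS : S.card ≠ k) : coords h v S = 0 := by
  rw [coords_apply, dif_neg hS]

theorem coords_bottom (v : ℂ[Tabloid n (twoRow n k h)]) (T : Tabloid n (twoRow n k h)) :
    coords h v T.bottom = v.coeff T := by
  rw [coords_apply, dif_pos T.card_bottom]
  congr 1
  exact Tabloid.bottom_injective (Tabloid.bottom_ofBottom _ _)

theorem coords_injective : Function.Injective (coords h) := by
  intro v w hvw
  ext T
  rw [← coords_bottom, hvw, coords_bottom]

open Pointwise in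
theorem coords_permutationModule (g : Equiv.Perm (Fin n)) (v : ℂ[Tabloid n (twoRow n k h)])
    (S : Finset (Fin n)) :
    coords h (permutationModule n (twoRow n k h) g v) S = coords h v (g⁻¹ • S) := by
  by_cases hS : S.card = k
  · have e : g⁻¹ • S = (g⁻¹ • Tabloid.ofBottom h S hS).bottom := by
      rw [Tabloid.bottom_smul, Tabloid.bottom_ofBottom]
    rw [e, coords_bottom, coords_apply, dif_pos hS, Representation.coeff_ofMulAction]
  · rw [coords_of_card_ne _ hS, coords_of_card_ne]
    rwa [Finset.card_smul_finset]

theorem exists_coords_eq {f : Finset (Fin n) → ℂ} (hf : ∀ S, f S ≠ 0 → S.card = k) :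
    ∃ v, coords h v = f := by
  have : Finite (Tabloid n (twoRow n k h)) := Finite.of_injective _ Tabloid.bottom_injective
  refine ⟨MonoidAlgebra.ofCoeff (Finsupp.equivFunOnFinite.symm fun T => f T.bottom), ?_⟩
  funext S
  by_cases hS : S.card = k
  · rw [coords_apply, dif_pos hS]
    simp
  · rw [coords_of_card_ne _ hS]
    by_contra hne
    exact hS (hf S (Ne.symm hne))

end Tabloids

/-! ### Specht modules of two-row shape -/

section Polytabloid

variable {n k : ℕ} {h : 2 * k ≤ n}

namespace Tableau

/-- The entry of the first row in column `j < k`. -/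
def top (t : Tableau n (twoRow n k h)) (j : Fin k) : Fin n :=
  t.symm ⟨(0, j), mem_twoRow.2 (Or.inl ⟨rfl, by have := j.2; simp only; omega⟩)⟩

/-- The entry of the second row in column `j < k`. -/
def bot (t : Tableau n (twoRow n k h)) (j : Fin k) : Fin n :=
  t.symm ⟨(1, j), mem_twoRow.2 (Or.inr ⟨rfl, j.2⟩)⟩

/-- The columns of length two of a tableau. -/
def columns (t : Tableau n (twoRow n k h)) : List (Fin n × Fin n) :=
  List.ofFn fun j => (t.top j, t.bot j)

variable (t : Tableau n (twoRow n k h))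

@[simp] theorem row_top (j : Fin k) : t.row (t.top j) = 0 := by simp [row, top]
@[simp] theorem row_bot (j : Fin k) : t.row (t.bot j) = 1 := by simp [row, bot]
@[simp] theorem col_top (j : Fin k) : t.col (t.top j) = j := by simp [col, top]
@[simp] theorem col_bot (j : Fin k) : t.col (t.bot j) = j := by simp [col, bot]

theorem ext_row_col {x y : Fin n} (hr : t.row x = t.row y) (hc : t.col x = t.col y) : x = y :=
  t.injective (Subtype.ext (Prod.ext hr hc))

theorem row_or (x : Fin n) : t.row x = 0 ∨ ∃ j, x = t.bot j := by
  rcases mem_twoRow.1 (t x).2 with h1 | h1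
  · exact Or.inl h1.1
  · exact Or.inr ⟨⟨_, h1.2⟩, t.ext_row_col (h1.1.trans (t.row_bot _).symm)
      (t.col_bot ⟨_, h1.2⟩).symm⟩

theorem top_ne_bot (i j : Fin k) : t.top i ≠ t.bot j := fun e => by
  simpa using congrArg t.row e

theorem top_injective : Function.Injective t.top := fun i j e =>
  Fin.ext (by simpa using congrArg t.col e)

theorem bot_injective : Function.Injective t.bot := fun i j e =>
  Fin.ext (by simpa using congrArg t.col e)

theorem nodup_entries_columns : (entries t.columns).Nodup := by
  rw [entries, List.nodup_flatMap]
  constructor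
  · intro p hp
    obtain ⟨j, rfl⟩ := (List.mem_ofFn' _ _).1 hp
    simp [t.top_ne_bot]
  · rw [columns, List.pairwise_ofFn]
    intro i j hij
    have h1 := t.top_injective.ne hij.ne
    have h2 := t.bot_injective.ne hij.ne
    simp only [Function.onFun, List.disjoint_cons_left, List.mem_cons, List.not_mem_nil, or_false,
      not_or]
    exact ⟨⟨h1, t.top_ne_bot _ _⟩, ⟨(t.top_ne_bot _ _).symm, h2⟩, by simp⟩

/-- The polytabloid changes sign under an odd element of the column stabilizer. -/
theorem polytabloid_permute {g : Equiv.Perm (Fin n)} (hg : g ∈ t.columnStabilizer) :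
    polytabloid (t.permute g) = (((Equiv.Perm.sign g : ℤˣ) : ℤ) : ℂ) • polytabloid t := by
  have hg' : ∀ x, t.col (g x) = t.col x := by simpa [columnStabilizer] using hg
  have hcol : ∀ x, (t.permute g).col x = t.col x := by
    intro x
    have := hg' (g⁻¹ x)
    simpa [permute, col, Equiv.Perm.inv_def] using this.symm
  rw [polytabloid, polytabloid, Finset.smul_sum]
  refine Finset.sum_bij (fun σ _ => σ * g) ?_ ?_ ?_ ?_
  · intro σ hσ
    simp only [columnStabilizer, Finset.mem_filter, Finset.mem_univ, true_and, hcol] at hσ ⊢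
    intro x
    rw [Equiv.Perm.mul_apply, hσ, hg']
  · intro σ _ τ _ e
    simpa using e
  · intro τ hτ
    simp only [columnStabilizer, Finset.mem_filter, Finset.mem_univ, true_and, hcol] at hτ ⊢
    refine ⟨τ * g⁻¹, fun x => ?_, by simp⟩
    rw [Equiv.Perm.mul_apply, hτ]
    simpa using (hg' (g⁻¹ x)).symm
  · intro σ _
    have e : (t.permute g).permute σ = t.permute (σ * g) := by
      refine Equiv.ext fun x => ?_
      simp [permute, Equiv.Perm.mul_def]
    have hs : (((Equiv.Perm.sign g : ℤˣ) : ℤ) : ℂ) * (((Equiv.Perm.sign g : ℤˣ) : ℤ) : ℂ) = 1 := by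
      rw [← Int.cast_mul, ← Units.val_mul, ← sq, Int.units_sq]; simp
    rw [e, MonoidAlgebra.smul_single, smul_eq_mul, Equiv.Perm.sign_mul, Units.val_mul,
      Int.cast_mul]
    congr 1
    linear_combination (-(((Equiv.Perm.sign σ : ℤˣ) : ℤ) : ℂ)) * hs

theorem swap_mem_columnStabilizer (j : Fin k) :
    Equiv.swap (t.top j) (t.bot j) ∈ t.columnStabilizer := by
  simp only [columnStabilizer, Finset.mem_filter, Finset.mem_univ, true_and]
  intro x
  rw [Equiv.swap_apply_def]
  split_ifs with h1 h2 <;> simp_all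

open Pointwise in
theorem coords_polytabloid_swap (j : Fin k) (S : Finset (Fin n)) :
    coords h (polytabloid t) (Equiv.swap (t.top j) (t.bot j) • S) =
      -coords h (polytabloid t) S := by
  have h1 := coords_permutationModule (Equiv.swap (t.top j) (t.bot j)) (polytabloid t) S
  rw [permutationModule_polytabloid, polytabloid_permute t (t.swap_mem_columnStabilizer j),
    map_smul, Equiv.Perm.sign_swap (t.top_ne_bot j j), Equiv.swap_inv] at h1
  rw [← h1]
  simp

/-- A coefficient of the polytabloid at a tabloid with no entry `t.top j` in its second row. -/
theorem coords_polytabloid_of_top_notMem {S : Finset (Fin n)} (hS : S.card = k)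
    (htop : ∀ j, t.top j ∉ S) :
    coords h (polytabloid t) S = if t.tabloid.bottom = S then 1 else 0 := by
  have key : ∀ σ ∈ t.columnStabilizer, (t.permute σ).tabloid = Tabloid.ofBottom h S hS → σ = 1 := by
    intro σ hσ e
    have hc : ∀ x, t.col (σ x) = t.col x := by simpa [columnStabilizer] using hσ
    have hc' : ∀ x, t.col (σ⁻¹ x) = t.col x := fun x => by simpa using (hc (σ⁻¹ x)).symm
    have hrow : ∀ x, t.row (σ⁻¹ x) = if x ∈ S then 1 else 0 := fun x =>
      congrFun (congrArg Subtype.val e) x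
    have htopfix : ∀ j, σ⁻¹ (t.top j) = t.top j := by
      intro j
      refine t.ext_row_col ?_ (hc' _)
      rw [hrow, if_neg (htop j), row_top]
    have hbotfix : ∀ j, σ⁻¹ (t.bot j) = t.bot j := by
      intro j
      refine t.ext_row_col ?_ (hc' _)
      rcases t.row_or (σ⁻¹ (t.bot j)) with h0 | ⟨i, hi⟩
      · have : σ⁻¹ (t.bot j) = t.top j :=
          t.ext_row_col (by simpa using h0) (by rw [hc']; simp)
        rw [← htopfix j] at this
        exact absurd (σ⁻¹.injective this).symm (t.top_ne_bot j j)
      · rw [hi]; simp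
    suffices σ⁻¹ = 1 from inv_eq_one.1 this
    ext1 x
    rw [Equiv.Perm.one_apply]
    rcases t.row_or x with h0 | ⟨j, rfl⟩
    · refine t.ext_row_col ?_ (hc' x)
      rcases t.row_or (σ⁻¹ x) with h1 | ⟨i, hi⟩
      · rw [h0, h1]
      · rw [← hbotfix i] at hi
        have := σ⁻¹.injective hi
        rw [this, row_bot] at h0
        exact absurd h0 one_ne_zero
    · exact hbotfix j
  have hone : (1 : Equiv.Perm (Fin n)) ∈ t.columnStabilizer := by simp [columnStabilizer]
  rw [coords_apply, dif_pos hS, polytabloid, MonoidAlgebra.coeff_sum, Finsupp.finsetSum_apply,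
    Finset.sum_eq_single 1]
  · have e : t.permute 1 = t := by ext x <;> rfl
    rw [e]
    have e2 : (t.tabloid = Tabloid.ofBottom h S hS) ↔ t.tabloid.bottom = S := by
      rw [← Tabloid.bottom_injective.eq_iff, Tabloid.bottom_ofBottom]
    simp [MonoidAlgebra.coeff_single, Finsupp.single_apply, e2]
  · intro σ hσ hne
    rw [MonoidAlgebra.coeff_single, Finsupp.single_apply, if_neg]
    exact fun e => hne (key σ hσ e)
  · exact fun hc => absurd hone hc

theorem bottom_tabloid : t.tabloid.bottom = Finset.univ.image t.bot := by
  ext x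
  have hm : x ∈ t.tabloid.bottom ↔ t.row x = 1 := by
    rw [Tabloid.bottom, Finset.mem_filter]
    exact and_iff_right (Finset.mem_univ x)
  rw [hm, Finset.mem_image]
  constructor
  · intro hx
    rcases t.row_or x with h0 | ⟨j, rfl⟩
    · omega
    · exact ⟨j, Finset.mem_univ j, rfl⟩
  · rintro ⟨j, -, rfl⟩
    simp

open Pointwise in
/-- In the model of the permutation module by multilinear polynomials, the polytabloid of `t` is
the product of the differences of the variables in the columns of `t`. -/
theorem coords_polytabloid : coords h (polytabloid t) = pairProd t.columns := by
  funext S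
  rw [pairProd_apply _ t.nodup_entries_columns]
  have hlen : t.columns.length = k := by simp [columns]
  rw [hlen]
  by_cases hS : S.card = k
  swap
  · rw [if_neg hS, coords_of_card_ne _ hS]
  rw [if_pos hS, columns, List.map_ofFn, List.prod_ofFn]
  simp only [Function.comp_apply]
  -- Both sides change sign when the two entries of a column are exchanged, so that all entries
  -- of the first row can be moved out of `S`, one by one.
  induction hm : (Finset.univ.filter fun j => t.top j ∈ S).card using Nat.strong_induction_on
    generalizing S with
  | _ m ih =>
  by_cases hex : ∃ j, t.top j ∈ S
  · obtain ⟨j, hj⟩ := hex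
    have hsw := t.coords_polytabloid_swap j S
    by_cases hb : t.bot j ∈ S
    · have hfix : Equiv.swap (t.top j) (t.bot j) • S = S := by
        ext x
        rw [← Finset.inv_smul_mem_iff, Equiv.swap_inv, Equiv.Perm.smul_def, Equiv.swap_apply_def]
        split_ifs with h1 h2 <;> simp_all
      rw [hfix] at hsw
      rw [Finset.prod_eq_zero (Finset.mem_univ j) (by simp [hj, hb])]
      exact self_eq_neg.1 hsw
    · have hmem : ∀ x, x ∈ Equiv.swap (t.top j) (t.bot j) • S ↔
          Equiv.swap (t.top j) (t.bot j) x ∈ S := fun x => by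
        rw [← Finset.inv_smul_mem_iff, Equiv.swap_inv, Equiv.Perm.smul_def]
      have htop : ∀ i, i ≠ j → Equiv.swap (t.top j) (t.bot j) (t.top i) = t.top i := fun i hi =>
        Equiv.swap_apply_of_ne_of_ne (t.top_injective.ne hi) (t.top_ne_bot _ _)
      have hbot : ∀ i, i ≠ j → Equiv.swap (t.top j) (t.bot j) (t.bot i) = t.bot i := fun i hi =>
        Equiv.swap_apply_of_ne_of_ne (t.top_ne_bot _ _).symm (t.bot_injective.ne hi)
      have hlt : (Finset.univ.filter fun i => t.top i ∈
          Equiv.swap (t.top j) (t.bot j) • S).card < m := by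
        rw [← hm]
        refine Finset.card_lt_card (Finset.ssubset_iff_subset_ne.2 ⟨fun i hi => ?_, fun e => ?_⟩)
        · simp only [Finset.mem_filter, Finset.mem_univ, true_and, hmem] at hi ⊢
          by_cases hij : i = j
          · subst hij; exact hj
          · rwa [htop i hij] at hi
        · have : j ∈ Finset.univ.filter fun i => t.top i ∈ S := by simp [hj]
          rw [← e] at this
          simp [hmem, hb] at this
      have := ih _ hlt _ (by rw [Finset.card_smul_finset, hS]) rfl
      rw [hsw] at this
      rw [← neg_inj, this, ← Finset.mul_prod_erase _ _ (Finset.mem_univ j),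
        ← Finset.mul_prod_erase _ _ (Finset.mem_univ j), ← neg_mul]
      congr 1
      · simp [hmem, hj, hb]
      · refine Finset.prod_congr rfl fun i hi => ?_
        have hij := (Finset.mem_erase.1 hi).1
        simp only [hmem, htop i hij, hbot i hij]
  · push Not at hex
    rw [t.coords_polytabloid_of_top_notMem hS hex]
    simp only [hex, if_false, sub_zero]
    rw [Finset.prod_ite_zero]
    have e : t.tabloid.bottom = S ↔ ∀ i ∈ Finset.univ, t.bot i ∈ S := by
      rw [bottom_tabloid]
      constructor
      · rintro rfl i _
        exact Finset.mem_image_of_mem _ (Finset.mem_univ i)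
      · intro hi
        refine Finset.eq_of_subset_of_card_le ?_ ?_
        · intro x hx
          obtain ⟨i, hi', rfl⟩ := Finset.mem_image.1 hx
          exact hi i hi'
        · rw [hS, Finset.card_image_of_injective _ t.bot_injective, Finset.card_fin]
    simp only [e, Finset.prod_const_one]

end Tableau

/-- Every list of `k` disjoint pairs consists of the columns of length two of some tableau. -/
theorem exists_columns_eq {L : List (Fin n × Fin n)} (hL : (entries L).Nodup)
    (hk : L.length = k) : ∃ t : Tableau n (twoRow n k h), t.columns = L := by
  have hlen : (entries L).length = 2 * k := by rw [length_entries, hk]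
  let f : Fin n → ℕ × ℕ := fun x => ((entries L).idxOf x % 2, (entries L).idxOf x / 2)
  obtain ⟨t, ht⟩ := Finset.exists_equiv_extend_of_card_eq
    (t := (twoRow n k h).cells) (s := (entries L).toFinset) (f := f)
    (by rw [card_twoRow, Fintype.card_fin])
    (by
      intro c hc
      obtain ⟨x, hx, rfl⟩ := Finset.mem_image.1 hc
      have := List.idxOf_lt_length_of_mem (List.mem_toFinset.1 hx)
      rw [hlen] at this
      rw [mem_twoRow]
      simp only [f]
      omega)
    (by
      intro x hx y hy e
      simp only [f, Prod.mk.injEq] at e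
      have hx' : x ∈ entries L := by simpa using hx
      exact (List.idxOf_inj hx').1 (by omega))
  have key : ∀ m x, (entries L)[m]? = some x → ((t x : ℕ × ℕ) = (m % 2, m / 2)) := by
    intro m x hm
    have hx : x ∈ entries L := List.mem_of_getElem? hm
    rw [ht x (List.mem_toFinset.2 hx)]
    obtain ⟨hm', rfl⟩ := List.getElem?_eq_some_iff.1 hm
    simp only [f, hL.idxOf_getElem]
  let t' : Tableau n (twoRow n k h) := t
  refine ⟨t', ?_⟩
  refine List.ext_get (by simp [Tableau.columns, hk]) fun j hj hj' => ?_
  obtain ⟨h1, h2⟩ := getElem_entries L j hj'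
  have k1 := key _ _ h1
  have k2 := key _ _ h2
  have hget : t'.columns.get ⟨j, hj⟩ =
      (t'.top ⟨j, hk ▸ hj'⟩, t'.bot ⟨j, hk ▸ hj'⟩) := by simp [Tableau.columns]
  rw [hget]
  have r1 : t'.row (L.get ⟨j, hj'⟩).1 = 0 := (congrArg Prod.fst k1).trans (by simp)
  have c1 : t'.col (L.get ⟨j, hj'⟩).1 = j := (congrArg Prod.snd k1).trans (by simp)
  have r2 : t'.row (L.get ⟨j, hj'⟩).2 = 1 := (congrArg Prod.fst k2).trans (by simp)
  have c2 : t'.col (L.get ⟨j, hj'⟩).2 = j := (congrArg Prod.snd k2).trans (by simp only; omega)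
  exact Prod.ext (t'.ext_row_col ((t'.row_top _).trans r1.symm) ((t'.col_top _).trans c1.symm))
    (t'.ext_row_col ((t'.row_bot _).trans r2.symm) ((t'.col_bot _).trans c2.symm))

/-- A vector of the permutation module lies in the Specht module if and only if the lowering
operator annihilates it. -/
theorem mem_specht_iff (v : ℂ[Tabloid n (twoRow n k h)]) :
    v ∈ (specht n (twoRow n k h)).toSubmodule ↔ lower Finset.univ (coords h v) = 0 := by
  have hmap : (specht n (twoRow n k h)).toSubmodule.map (coords h) =
      Submodule.span ℂ (pairProds Finset.univ k) := by
    change (Submodule.span ℂ _).map _ = _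
    rw [Submodule.map_span]
    congr 1
    ext f
    constructor
    · rintro ⟨_, ⟨t, rfl⟩, rfl⟩
      exact ⟨t.columns, t.nodup_entries_columns, by simp, by simp [Tableau.columns],
        t.coords_polytabloid⟩
    · rintro ⟨L, h1, -, h3, rfl⟩
      obtain ⟨t, rfl⟩ := exists_columns_eq (h := h) h1 h3
      exact ⟨_, ⟨t, rfl⟩, t.coords_polytabloid⟩
  constructor
  · intro hv
    refine lower_eq_zero_of_mem_span (k := k) ?_
    rw [← hmap]
    exact Submodule.mem_map_of_mem hv
  · intro hv
    have hm : coords h v ∈ Submodule.span ℂ (pairProds Finset.univ k) := by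
      refine mem_span_pairProds (fun S hS => ⟨Finset.subset_univ S, ?_⟩) fun S _ => by rw [hv]; rfl
      by_contra hc
      exact hS (coords_of_card_ne v hc)
    rw [← hmap] at hm
    obtain ⟨w, hw, hwv⟩ := hm
    rwa [← coords_injective hwv]

end Polytabloid

/-! ### The character of a two-row Specht module -/

section Level

variable {n : ℕ}

/-- The sets of cardinality `k - e`.  The subtraction is not truncated: for `k < e` there are no
such sets, so that `Level n 1 0` is empty. -/
abbrev Level (n e k : ℕ) : Type := {S : Finset (Fin n) // S.card + e = k}

/-- Extension by zero of a function on a level to all finite sets. -/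
def extend (e k : ℕ) : (Level n e k → ℂ) →ₗ[ℂ] (Finset (Fin n) → ℂ) where
  toFun w S := if hS : S.card + e = k then w ⟨S, hS⟩ else 0
  map_add' v w := by ext S; by_cases hS : S.card + e = k <;> simp [hS]
  map_smul' c v := by ext S; by_cases hS : S.card + e = k <;> simp [hS]

/-- Restriction to a level of a function on finite sets. -/
def restrict (e k : ℕ) : (Finset (Fin n) → ℂ) →ₗ[ℂ] (Level n e k → ℂ) :=
  LinearMap.funLeft ℂ ℂ Subtype.val

theorem extend_apply {e k : ℕ} (w : Level n e k → ℂ) (S : Finset (Fin n)) :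
    extend e k w S = if hS : S.card + e = k then w ⟨S, hS⟩ else 0 := rfl

theorem restrict_apply {e k : ℕ} (f : Finset (Fin n) → ℂ) (S : Level n e k) :
    restrict e k f S = f S.1 := rfl

theorem extend_of_ne {e k : ℕ} (w : Level n e k → ℂ) {S : Finset (Fin n)} (hS : S.card + e ≠ k) :
    extend e k w S = 0 := by
  rw [extend_apply, dif_neg hS]

theorem restrict_extend {e k : ℕ} (w : Level n e k → ℂ) : restrict e k (extend e k w) = w := by
  funext S
  rw [restrict_apply, extend_apply, dif_pos S.2]

theorem raise_extend_of_card_ne {k : ℕ} (w : Level n 1 k → ℂ) {S : Finset (Fin n)}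
    (hS : S.card ≠ k) : raise (extend 1 k w) S = 0 := by
  rw [raise_apply]
  refine Finset.sum_eq_zero fun x hx => extend_of_ne w ?_
  rwa [Finset.card_erase_add_one hx]

theorem lower_of_card_ne {k : ℕ} {f : Finset (Fin n) → ℂ} (hf : ∀ S, S.card ≠ k → f S = 0)
    {S : Finset (Fin n)} (hS : S.card + 1 ≠ k) : lower Finset.univ f S = 0 := by
  rw [lower_apply]
  refine Finset.sum_eq_zero fun x hx => hf _ ?_
  rwa [Finset.card_insert_of_notMem (Finset.mem_sdiff.1 hx).2]

theorem eq_zero_of_lower_raise_extend {k : ℕ} (h : 2 * k ≤ n) {w : Level n 1 k → ℂ}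
    (hw : lower Finset.univ (raise (extend 1 k w)) = 0) : w = 0 := by
  have h0 : extend 1 k w = 0 := by
    refine eq_zero_of_lower_raise (A := Finset.univ) (fun S hS => ⟨Finset.subset_univ S, ?_⟩)
      fun S _ => by rw [hw]; rfl
    have : S.card + 1 = k := by
      by_contra hc
      exact hS (extend_of_ne w hc)
    rw [Finset.card_fin]
    omega
  rw [← restrict_extend w, h0, map_zero]

/-- Below the middle degree `lower ∘ raise` is bijective on each level. -/
theorem exists_lower_raise_eq {k : ℕ} (h : 2 * k ≤ n) {f : Finset (Fin n) → ℂ}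
    (hf : ∀ S, S.card + 1 ≠ k → f S = 0) :
    ∃ w : Level n 1 k → ℂ, lower Finset.univ (raise (extend 1 k w)) = f := by
  let B : (Level n 1 k → ℂ) →ₗ[ℂ] (Level n 1 k → ℂ) :=
    restrict 1 k ∘ₗ lower Finset.univ ∘ₗ raise ∘ₗ extend 1 k
  have hlow : ∀ w : Level n 1 k → ℂ, ∀ S : Finset (Fin n), S.card + 1 ≠ k →
      lower Finset.univ (raise (extend 1 k w)) S = 0 := fun w S hS =>
    lower_of_card_ne (fun S hS => raise_extend_of_card_ne w hS) hS
  have hinj : Function.Injective B := by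
    rw [← LinearMap.ker_eq_bot, LinearMap.ker_eq_bot']
    intro w hw
    apply eq_zero_of_lower_raise_extend h
    funext S
    by_cases hS : S.card + 1 = k
    · exact congrFun hw ⟨S, hS⟩
    · exact hlow w S hS
  obtain ⟨w, hw⟩ := LinearMap.injective_iff_surjective.1 hinj (restrict 1 k f)
  refine ⟨w, funext fun S => ?_⟩
  by_cases hS : S.card + 1 = k
  · exact congrFun hw ⟨S, hS⟩
  · rw [hlow w S hS, hf S hS]

/-- The trace of a permutation-like matrix counts fixed points. -/
theorem trace_funLeft {X : Type*} [Fintype X] [DecidableEq X] (φ : X → X) :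
    LinearMap.trace ℂ (X → ℂ) (LinearMap.funLeft ℂ ℂ φ) =
      ((Finset.univ.filter fun x => φ x = x).card : ℂ) := by
  rw [LinearMap.trace_eq_matrix_trace ℂ (Pi.basisFun ℂ X), Matrix.trace]
  simp [LinearMap.funLeft_apply, Pi.single_apply]

open Pointwise in
/-- The translation of finite sets by a permutation, on a level. -/
def Level.translate {e k : ℕ} (g : Equiv.Perm (Fin n)) (S : Level n e k) : Level n e k :=
  ⟨g • S.1, by rw [Finset.card_smul_finset]; exact S.2⟩

open Pointwise in
theorem raise_smul {f f' : Finset (Fin n) → ℂ} (g : Equiv.Perm (Fin n))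
    (hf : ∀ S, f' S = f (g • S)) (S : Finset (Fin n)) : raise f' S = raise f (g • S) := by
  rw [raise_apply, raise_apply]
  refine Finset.sum_bij (fun x _ => g • x) (fun x hx => Finset.smul_mem_smul_finset hx)
    (fun x _ y _ e => by simpa using e) (fun y hy => ?_) (fun x hx => ?_)
  · obtain ⟨x, hx, rfl⟩ := Finset.mem_smul_finset.1 hy
    exact ⟨x, hx, rfl⟩
  · rw [hf]
    congr 1
    ext z
    rw [Finset.mem_erase, ← Finset.inv_smul_mem_iff, ← Finset.inv_smul_mem_iff, Finset.mem_erase,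
      Ne, Ne, inv_smul_eq_iff]

variable {k : ℕ} (h : 2 * k ≤ n)

/-- The decomposition of the functions on `k`-sets into the Specht module and the image of the
functions on `(k - 1)`-sets under the raising operator. -/
noncomputable def spechtSum :
    ((specht n (twoRow n k h)).toSubmodule × (Level n 1 k → ℂ)) →ₗ[ℂ] (Level n 0 k → ℂ) :=
  restrict 0 k ∘ₗ
    LinearMap.coprod (coords h ∘ₗ Submodule.subtype _) (raise ∘ₗ extend 1 k)

theorem spechtSum_apply (v : (specht n (twoRow n k h)).toSubmodule) (w : Level n 1 k → ℂ)
    (S : Level n 0 k) :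
    spechtSum h (v, w) S = coords h v.1 S.1 + raise (extend 1 k w) S.1 := rfl

theorem spechtSum_bijective : Function.Bijective (spechtSum h) := by
  constructor
  · rw [← LinearMap.ker_eq_bot, LinearMap.ker_eq_bot']
    rintro ⟨v, w⟩ hvw
    have h0 : coords h v.1 + raise (extend 1 k w) = 0 := by
      funext S
      by_cases hS : S.card = k
      · exact congrFun hvw ⟨S, hS⟩
      · rw [Pi.add_apply, coords_of_card_ne _ hS, raise_extend_of_card_ne w hS]; simp
    have hw : w = 0 := by
      apply eq_zero_of_lower_raise_extend h
      have := congrArg (lower Finset.univ) h0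
      rwa [map_add, (mem_specht_iff v.1).1 v.2, zero_add, map_zero] at this
    subst hw
    have hv : v.1 = 0 := coords_injective (h := h) (by simpa using h0)
    rw [Prod.mk_eq_zero]
    exact ⟨Subtype.ext hv, rfl⟩
  · intro f
    have hf0 : ∀ S : Finset (Fin n), S.card ≠ k → extend 0 k f S = 0 := fun S hS =>
      extend_of_ne f hS
    obtain ⟨w, hw⟩ := exists_lower_raise_eq h (f := lower Finset.univ (extend 0 k f))
      fun S hS => lower_of_card_ne hf0 hS
    obtain ⟨v, hv⟩ := exists_coords_eq (h := h) (f := extend 0 k f - raise (extend 1 k w)) (by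
      intro S hS
      by_contra hc
      exact hS (by rw [Pi.sub_apply, hf0 S hc, raise_extend_of_card_ne w hc, sub_zero]))
    refine ⟨(⟨v, (mem_specht_iff v).2 (by rw [hv, map_sub, hw, sub_self])⟩, w), ?_⟩
    funext S
    rw [spechtSum_apply]
    simp only [hv, Pi.sub_apply, sub_add_cancel]
    exact congrFun (restrict_extend f) S

open Pointwise in
/-- The value of the character of the two-row Specht module is the number of invariant `k`-sets
minus the number of invariant `(k - 1)`-sets. -/
theorem irreducibleCharacter_twoRow (g : Equiv.Perm (Fin n)) :
    irreducibleCharacter n (twoRow n k h) g =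
      ((Finset.univ.filter fun S : Level n 0 k => S.translate g⁻¹ = S).card : ℂ) -
        ((Finset.univ.filter fun S : Level n 1 k => S.translate g⁻¹ = S).card : ℂ) := by
  have : Finite (Tabloid n (twoRow n k h)) := Finite.of_injective _ Tabloid.bottom_injective
  have : Module.Finite ℂ (specht n (twoRow n k h)).toSubmodule := inferInstance
  let F := LinearEquiv.ofBijective (spechtSum h) (spechtSum_bijective h)
  let ρ := (specht n (twoRow n k h)).toRepresentation g
  have key : F.conj (ρ.prodMap (LinearMap.funLeft ℂ ℂ (Level.translate g⁻¹))) =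
      LinearMap.funLeft ℂ ℂ (Level.translate g⁻¹) := by
    refine LinearMap.ext fun f => ?_
    obtain ⟨⟨v, w⟩, rfl⟩ := F.surjective f
    rw [LinearEquiv.conj_apply_apply, LinearEquiv.symm_apply_apply]
    funext S
    change spechtSum h (ρ v, LinearMap.funLeft ℂ ℂ (Level.translate g⁻¹) w) S =
      spechtSum h (v, w) (S.translate g⁻¹)
    rw [spechtSum_apply, spechtSum_apply]
    congr 1
    · exact coords_permutationModule g v.1 S.1
    · refine raise_smul g⁻¹ (fun S => ?_) S.1
      rw [extend_apply, extend_apply]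
      by_cases hS : S.card + 1 = k
      · rw [dif_pos hS, dif_pos (by rwa [Finset.card_smul_finset])]
        rfl
      · rw [dif_neg hS, dif_neg (by rwa [Finset.card_smul_finset])]
  have htr := LinearMap.trace_conj' (ρ.prodMap (LinearMap.funLeft ℂ ℂ (Level.translate g⁻¹))) F
  rw [key, LinearMap.trace_prodMap', trace_funLeft, trace_funLeft] at htr
  rw [htr, add_sub_cancel_right]
  rfl

end Level

/-! ### Generating functions for the characters -/

section GeneratingFunction

open Polynomial

/-- The generating function, by cardinality, of the subsets of `A` that are stable under `σ`. -/
noncomputable def stablePoly {α : Type*} [DecidableEq α] (σ : α → α) (A : Finset α) : ℂ[X] :=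
  ∑ S ∈ A.powerset, if ∀ x ∈ S, σ x ∈ S then X ^ S.card else 0

/-- For an involution, each fixed point contributes a factor `1 + X` and each `2`-cycle a factor
`1 + X ^ 2`. -/
theorem stablePoly_eq {α : Type*} [DecidableEq α] {σ : α → α} (hσ : ∀ x, σ (σ x) = x)
    {A : Finset α} (hA : ∀ x ∈ A, σ x ∈ A) {m : ℕ}
    (hm : (A.filter fun x => σ x ≠ x).card = 2 * m) :
    stablePoly σ A = (1 + X) ^ (A.filter fun x => σ x = x).card * (1 + X ^ 2) ^ m := by
  induction hc : A.card using Nat.strong_induction_on generalizing A m with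
  | _ c ih =>
  rcases A.eq_empty_or_nonempty with rfl | ⟨a, ha⟩
  · have : m = 0 := by simpa using hm.symm
    simp [stablePoly, this]
  by_cases hfix : σ a = a
  · -- A fixed point `a` may be added to or removed from a stable set.
    set B := A.erase a with hB
    have haB : a ∉ B := by simp [hB]
    have hAB : A = insert a B := (Finset.insert_erase ha).symm
    have hBσ : ∀ x ∈ B, σ x ∈ B := by
      intro x hx
      rw [hB, Finset.mem_erase] at hx ⊢
      refine ⟨fun e => hx.1 ?_, hA x hx.2⟩
      rw [← hσ x, e, hfix]
    have hmB : (B.filter fun x => σ x ≠ x).card = 2 * m := by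
      rw [← hm, hAB, Finset.filter_insert, if_neg (by simp [hfix])]
    have hlt : B.card < c := by rw [← hc]; exact Finset.card_erase_lt_of_mem ha
    have hfx : (A.filter fun x => σ x = x).card = (B.filter fun x => σ x = x).card + 1 := by
      rw [hAB, Finset.filter_insert, if_pos hfix, Finset.card_insert_of_notMem (by simp [haB])]
    have hsplit : stablePoly σ A = (1 + X) * stablePoly σ B := by
      rw [stablePoly, hAB, Finset.sum_powerset_insert haB, add_mul, one_mul, stablePoly,
        Finset.mul_sum]
      congr 1
      refine Finset.sum_congr rfl fun S hS => ?_
      have haS : a ∉ S := fun h => haB (Finset.mem_powerset.1 hS h)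
      have hiff : (∀ x ∈ insert a S, σ x ∈ insert a S) ↔ ∀ x ∈ S, σ x ∈ S := by
        simp only [Finset.mem_insert, forall_eq_or_imp, hfix, true_or, true_and]
        refine forall₂_congr fun x hx => or_iff_right fun e => haS ?_
        have : x = a := by rw [← hσ x, e, hfix]
        exact this ▸ hx
      simp only [hiff, Finset.card_insert_of_notMem haS]
      split_ifs <;> ring
    rw [hsplit, ih _ hlt hBσ hmB rfl, hfx, pow_succ]
    ring
  · -- A stable set contains both or none of the elements `a` and `σ a`.
    set b := σ a with hb
    have hba : σ b = a := hσ a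
    set B := (A.erase a).erase b with hB
    have hbA : b ∈ A.erase a := Finset.mem_erase.2 ⟨hfix, hA a ha⟩
    have hbB : b ∉ B := by simp [hB]
    have haB : a ∉ insert b B := by rw [hB, Finset.insert_erase hbA]; simp
    have haB' : a ∉ B := fun h => haB (Finset.mem_insert_of_mem h)
    have hAB : A = insert a (insert b B) := by
      rw [hB, Finset.insert_erase hbA, Finset.insert_erase ha]
    have hne : ∀ x, x ≠ a → x ≠ b → σ x ≠ a ∧ σ x ≠ b := by
      intro x hxa hxb
      refine ⟨fun e => hxb ?_, fun e => hxa ?_⟩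
      · rw [← hσ x, e]
      · rw [← hσ x, e, hba]
    have hBσ : ∀ x ∈ B, σ x ∈ B := by
      intro x hx
      simp only [hB, Finset.mem_erase] at hx ⊢
      have := hne x hx.2.1 hx.1
      exact ⟨this.2, this.1, hA x hx.2.2⟩
    have hfx : (A.filter fun x => σ x = x) = B.filter fun x => σ x = x := by
      rw [hAB, Finset.filter_insert, if_neg hfix, Finset.filter_insert,
        if_neg (by rw [hba]; exact Ne.symm hfix)]
    have hmv : (A.filter fun x => σ x ≠ x).card = (B.filter fun x => σ x ≠ x).card + 2 := by
      rw [hAB, Finset.filter_insert, if_pos hfix, Finset.filter_insert,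
        if_pos (by rw [hba]; exact Ne.symm hfix), Finset.card_insert_of_notMem,
        Finset.card_insert_of_notMem (by simp [hbB])]
      simp [haB', Ne.symm hfix]
    have hlt : B.card < c := by
      rw [← hc, hAB, Finset.card_insert_of_notMem haB, Finset.card_insert_of_notMem hbB]
      omega
    have hmB : (B.filter fun x => σ x ≠ x).card = 2 * (m - 1) := by omega
    have hsplit : stablePoly σ A = (1 + X ^ 2) * stablePoly σ B := by
      rw [stablePoly, hAB, Finset.sum_powerset_insert haB, Finset.sum_powerset_insert hbB,
        Finset.sum_powerset_insert hbB, add_mul, one_mul, stablePoly, Finset.mul_sum]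
      have haS : ∀ S ∈ B.powerset, a ∉ S := fun S hS h => haB' (Finset.mem_powerset.1 hS h)
      have hbS : ∀ S ∈ B.powerset, b ∉ S := fun S hS h => hbB (Finset.mem_powerset.1 hS h)
      have z1 : (∑ S ∈ B.powerset, if ∀ x ∈ insert b S, σ x ∈ insert b S then
          (X : ℂ[X]) ^ (insert b S).card else 0) = 0 := by
        refine Finset.sum_eq_zero fun S hS => if_neg fun h => ?_
        have := h b (Finset.mem_insert_self _ _)
        rw [hba, Finset.mem_insert] at this
        exact this.elim (Ne.symm hfix) (haS S hS)
      have z2 : (∑ S ∈ B.powerset, if ∀ x ∈ insert a S, σ x ∈ insert a S then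
          (X : ℂ[X]) ^ (insert a S).card else 0) = 0 := by
        refine Finset.sum_eq_zero fun S hS => if_neg fun h => ?_
        have := h a (Finset.mem_insert_self _ _)
        rw [← hb, Finset.mem_insert] at this
        exact this.elim hfix (hbS S hS)
      rw [z1, z2, add_zero, zero_add]
      congr 1
      refine Finset.sum_congr rfl fun S hS => ?_
      have hiff : (∀ x ∈ insert a (insert b S), σ x ∈ insert a (insert b S)) ↔
          ∀ x ∈ S, σ x ∈ S := by
        simp only [Finset.mem_insert, forall_eq_or_imp, ← hb, hba, true_or, or_true, true_and]
        refine forall₂_congr fun x hx => ?_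
        have := hne x (fun e => haS S hS (e ▸ hx)) (fun e => hbS S hS (e ▸ hx))
        simp [this]
      have hcard : (insert a (insert b S)).card = S.card + 2 := by
        rw [Finset.card_insert_of_notMem, Finset.card_insert_of_notMem (hbS S hS)]
        simp [haS S hS, Ne.symm hfix]
      simp only [hiff, hcard]
      split_ifs <;> ring
    have hm1 : m = (m - 1) + 1 := by omega
    rw [hsplit, ih _ hlt hBσ hmB rfl, hfx]
    conv_rhs => rw [hm1, pow_succ]
    ring

open Pointwise in
theorem card_translate_eq {n : ℕ} (e k : ℕ) (g : Equiv.Perm (Fin n)) :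
    ((Finset.univ.filter fun S : Level n e k => S.translate g⁻¹ = S).card : ℂ) =
      (X ^ e * stablePoly g Finset.univ).coeff k := by
  have hstab : ∀ S : Finset (Fin n), g⁻¹ • S = S ↔ ∀ x ∈ S, g x ∈ S := by
    intro S
    rw [inv_smul_eq_iff]
    constructor
    · intro h x hx
      rw [h]
      exact Finset.smul_mem_smul_finset hx
    · intro h
      refine (Finset.eq_of_subset_of_card_le ?_ (by rw [Finset.card_smul_finset])).symm
      intro y hy
      obtain ⟨x, hx, rfl⟩ := Finset.mem_smul_finset.1 hy
      exact h x hx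
  have h1 : (Finset.univ.filter fun S : Level n e k => S.translate g⁻¹ = S).card =
      (Finset.univ.filter fun S : Finset (Fin n) =>
        (∀ x ∈ S, g x ∈ S) ∧ S.card + e = k).card := by
    refine Finset.card_bij (fun S _ => S.1) ?_ ?_ ?_
    · intro S hS
      have h2 := congrArg Subtype.val (Finset.mem_filter.1 hS).2
      exact Finset.mem_filter.2 ⟨Finset.mem_univ _, (hstab S.1).1 h2, S.2⟩
    · exact fun S _ T _ e => Subtype.ext e
    · intro S hS
      have h2 := (Finset.mem_filter.1 hS).2
      exact ⟨⟨S, h2.2⟩, Finset.mem_filter.2 ⟨Finset.mem_univ _,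
        Subtype.ext ((hstab S).2 h2.1)⟩, rfl⟩
  rw [h1, stablePoly, Finset.mul_sum, Polynomial.finsetSum_coeff, Finset.powerset_univ,
    Finset.card_filter, Nat.cast_sum]
  refine Finset.sum_congr rfl fun S _ => ?_
  by_cases h2 : ∀ x ∈ S, g x ∈ S
  · rw [if_pos h2, ← pow_add, coeff_X_pow]
    by_cases h3 : S.card + e = k
    · rw [if_pos ⟨h2, h3⟩, if_pos (by omega)]; simp
    · rw [if_neg (fun h => h3 h.2), if_neg (by omega)]; simp
  · rw [if_neg (fun h => h2 h.1), if_neg h2]; simp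

/-- A permutation of cycle type `2^j 1^(n-2j)` is an involution with `n - 2 j` fixed points. -/
theorem stablePoly_of_cycleType {n j : ℕ} {g : Equiv.Perm (Fin n)}
    (hg : g.cycleType = Multiset.replicate j 2) :
    stablePoly g Finset.univ = (1 + X) ^ (n - 2 * j) * (1 + X ^ 2) ^ j := by
  have hsq : g ^ 2 = 1 := by
    rw [← orderOf_dvd_iff_pow_eq_one, ← Equiv.Perm.lcm_cycleType, hg, Multiset.lcm_dvd]
    intro b hb
    rw [Multiset.eq_of_mem_replicate hb]
  have hinv : ∀ x, g (g x) = x := fun x => by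
    rw [← Equiv.Perm.mul_apply, ← sq, hsq, Equiv.Perm.one_apply]
  have hsupp : (Finset.univ.filter fun x => g x ≠ x).card = 2 * j := by
    have h1 := Equiv.Perm.sum_cycleType g
    rw [hg, Multiset.sum_replicate, smul_eq_mul] at h1
    rw [mul_comm, h1]
    rfl
  have hfix : (Finset.univ.filter fun x => g x = x).card = n - 2 * j := by
    have := Finset.card_filter_add_card_filter_not (s := (Finset.univ : Finset (Fin n)))
      (fun x => g x = x)
    rw [Finset.card_fin] at this
    have h2 : (Finset.univ.filter fun x => ¬g x = x).card = 2 * j := hsupp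
    omega
  rw [stablePoly_eq hinv (fun x _ => Finset.mem_univ _) hsupp, hfix]

theorem characterAt_twoRow {n k j : ℕ} (h : 2 * k ≤ n) (hj : 2 * j ≤ n) :
    characterAt n (twoRow n k h) j =
      ((1 - X) * ((1 + X) ^ (n - 2 * j) * (1 + X ^ 2) ^ j) : ℂ[X]).coeff k := by
  have hex : ∃ σ : Equiv.Perm (Fin n), σ.cycleType = Multiset.replicate j 2 := by
    rw [Equiv.Perm.exists_with_cycleType_iff]
    refine ⟨by simp; omega, fun a ha => (Multiset.eq_of_mem_replicate ha).ge⟩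
  have key : ∀ g : Equiv.Perm (Fin n), g.cycleType = Multiset.replicate j 2 →
      irreducibleCharacter n (twoRow n k h) g =
        ((1 - X) * ((1 + X) ^ (n - 2 * j) * (1 + X ^ 2) ^ j) : ℂ[X]).coeff k := by
    intro g hg
    rw [irreducibleCharacter_twoRow, card_translate_eq, card_translate_eq,
      stablePoly_of_cycleType hg, sub_mul, coeff_sub, pow_zero, pow_one]
  rw [characterAt, dif_pos hex]
  exact key _ hex.choose_spec

/-- The generating function of the numbers `α`. -/
theorem alpha_eq_coeff {n k i : ℕ} (hk : 2 * k ≤ n) (hi : 2 * i ≤ n) :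
    alpha n (k : ℤ) i =
      ((1 - X) * ((1 + X) ^ (n - 2 * i) * (1 + X + X ^ 2) ^ i) : ℂ[X]).coeff k := by
  have hc : 0 ≤ (k : ℤ) ∧ 2 * (k : ℤ) ≤ (n : ℤ) ∧ 2 * i ≤ n := ⟨by omega, by omega, hi⟩
  rw [alpha, dif_pos hc]
  simp only [Int.toNat_natCast]
  -- The binomial theorem for `2 * (1 + X + X ^ 2) = (1 + X ^ 2) + (1 + X) ^ 2`.
  have hpoly : ((1 - X) * ((1 + X) ^ (n - 2 * i) * (C 2 * (1 + X + X ^ 2)) ^ i) : ℂ[X]) =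
      ∑ j ∈ Finset.range (i + 1), C (i.choose j : ℂ) *
        ((1 - X) * ((1 + X) ^ (n - 2 * j) * (1 + X ^ 2) ^ j)) := by
    have hbin : (C 2 * (1 + X + X ^ 2) : ℂ[X]) = (1 + X ^ 2) + (1 + X) ^ 2 := by
      rw [show (C 2 : ℂ[X]) = 2 from rfl]; ring
    rw [hbin, add_pow (1 + X ^ 2 : ℂ[X]), Finset.mul_sum, Finset.mul_sum]
    refine Finset.sum_congr rfl fun j hj => ?_
    have hji : j ≤ i := by simpa [Nat.lt_succ_iff] using hj
    have e : n - 2 * j = (n - 2 * i) + 2 * (i - j) := by omega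
    rw [e, pow_add, pow_mul (1 + X : ℂ[X]) 2, C_eq_natCast]
    ring
  have hsum : (∑ j ∈ Finset.range (i + 1), (i.choose j : ℂ) *
      characterAt n (twoRow n k (by omega)) j) =
      ((1 - X) * ((1 + X) ^ (n - 2 * i) * (C 2 * (1 + X + X ^ 2)) ^ i) : ℂ[X]).coeff k := by
    rw [hpoly, finsetSum_coeff]
    refine Finset.sum_congr rfl fun j hj => ?_
    have hji : j ≤ i := by simpa [Nat.lt_succ_iff] using hj
    rw [characterAt_twoRow hk (by omega), coeff_C_mul]
  have hfac : ((1 - X) * ((1 + X) ^ (n - 2 * i) * (C 2 * (1 + X + X ^ 2)) ^ i) : ℂ[X]) =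
      C (2 ^ i) * ((1 - X) * ((1 + X) ^ (n - 2 * i) * (1 + X + X ^ 2) ^ i)) := by
    rw [mul_pow, C_pow]; ring
  rw [shapeAlpha, hsum, hfac, coeff_C_mul, mul_div_cancel_left₀ _ (pow_ne_zero _ two_ne_zero)]

end GeneratingFunction

/-! ### Riordan paths -/

section Riordan

open Polynomial

/-- The solution of the recurrence for unconstrained Motzkin paths which is `1` at height `0`, `-1`
at height `-1`, and `0` at the other heights at time `0`. -/
def reflected : ℕ → ℤ → ℤ
  | 0, h => if h = 0 then 1 else if h = -1 then -1 else 0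
  | n + 1, h => reflected n (h - 1) + reflected n h + reflected n (h + 1)

theorem reflected_neg (n : ℕ) (h : ℤ) : reflected n (-1 - h) = -reflected n h := by
  induction n generalizing h with
  | zero =>
    simp only [reflected]
    split_ifs <;> omega
  | succ n ih =>
    have h1 := ih (h - 1)
    have h2 := ih (h + 1)
    simp only [reflected]
    rw [show -1 - h - 1 = -1 - (h + 1) by ring, show -1 - h + 1 = -1 - (h - 1) by ring, h1, h2,
      ih h]
    ring

theorem reflected_of_lt {n : ℕ} {h : ℤ} (hn : (n : ℤ) < h) : reflected n h = 0 := by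
  induction n generalizing h with
  | zero =>
    simp only [reflected]
    split_ifs <;> omega
  | succ n ih =>
    push_cast at hn
    simp only [reflected]
    rw [ih (by omega), ih (by omega), ih (by omega)]
    ring

/-- The exponent `m` corresponds to the height `n - m`, as `X ^ (-n) (1 + X + X ^ 2) ^ n` is the
generating function of the heights reached by `n` steps `1`, `0`, `-1`. -/
theorem coeff_trinomial (n m : ℕ) :
    ((1 - X) * (1 + X + X ^ 2) ^ n : ℂ[X]).coeff m = (reflected n ((n : ℤ) - m) : ℂ) := by
  induction n generalizing m with
  | zero =>
    rw [pow_zero, mul_one, coeff_sub, coeff_one, coeff_X]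
    rcases m with _ | _ | m
    · simp [reflected]
    · simp [reflected]
    · have h1 : ¬((0 : ℤ) - ((m + 1 + 1 : ℕ) : ℤ) = 0) := by push_cast; omega
      have h2 : ¬((0 : ℤ) - ((m + 1 + 1 : ℕ) : ℤ) = -1) := by push_cast; omega
      simp only [reflected, Nat.cast_zero, if_neg h1, if_neg h2]
      simp
  | succ n ih =>
    have e : ((1 - X) * (1 + X + X ^ 2) ^ (n + 1) : ℂ[X]) =
        (1 - X) * (1 + X + X ^ 2) ^ n + (1 - X) * (1 + X + X ^ 2) ^ n * X +
          (1 - X) * (1 + X + X ^ 2) ^ n * X ^ 2 := by ring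
    rw [e, coeff_add, coeff_add, ih, reflected]
    have e1 : ((1 - X) * (1 + X + X ^ 2) ^ n * X : ℂ[X]).coeff m =
        (reflected n ((n : ℤ) + 1 - m) : ℂ) := by
      rcases m with _ | m
      · rw [coeff_mul_X_zero, reflected_of_lt (by push_cast; omega)]; simp
      · rw [coeff_mul_X, ih]; congr 2; push_cast; ring
    have e2 : ((1 - X) * (1 + X + X ^ 2) ^ n * X ^ 2 : ℂ[X]).coeff m =
        (reflected n ((n : ℤ) + 2 - m) : ℂ) := by
      rw [coeff_mul_X_pow']
      split_ifs with hm
      · rw [ih]; congr 2; push_cast [hm]; ring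
      · rw [reflected_of_lt (by omega)]; simp
    rw [e1, e2]
    push_cast
    rw [show (n : ℤ) + 1 - m - 1 = n - m by ring, show (n : ℤ) + 1 - m + 1 = n + 2 - m by ring]

/-- The defining conditions of a Riordan path, except that the path may end at any height. -/
def IsRiordanPrefix {n : ℕ} (s : Fin n → SignType) : Prop :=
  (∀ m ≤ n, 0 ≤ pathHeight s m) ∧ ∀ j : Fin n, s j = 0 → pathHeight s j.val ≠ 0

open Classical in
/-- The number of Riordan prefixes of length `n` that end at height `h`. -/
noncomputable def prefixCount (n : ℕ) (h : ℤ) : ℕ :=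
  (Finset.univ.filter fun s : Fin n → SignType => IsRiordanPrefix s ∧ pathHeight s n = h).card

theorem pathHeight_snoc {n : ℕ} (s : Fin n → SignType) (e : SignType) {m : ℕ} (hm : m ≤ n) :
    pathHeight (Fin.snoc s e : Fin (n + 1) → SignType) m = pathHeight s m := by
  simp only [pathHeight, Finset.sum_filter]
  rw [Fin.sum_univ_castSucc]
  simp only [Fin.snoc_castSucc, Fin.val_castSucc, Fin.snoc_last, Fin.val_last]
  rw [if_neg (by omega), add_zero]

theorem pathHeight_snoc_last {n : ℕ} (s : Fin n → SignType) (e : SignType) :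
    pathHeight (Fin.snoc s e : Fin (n + 1) → SignType) (n + 1) = pathHeight s n + e := by
  simp only [pathHeight, Finset.sum_filter]
  rw [Fin.sum_univ_castSucc]
  simp only [Fin.snoc_castSucc, Fin.val_castSucc, Fin.snoc_last, Fin.val_last]
  rw [if_pos (by omega)]
  congr 1
  refine Finset.sum_congr rfl fun j _ => ?_
  rw [if_pos (by omega), if_pos j.2]

theorem isRiordanPrefix_snoc {n : ℕ} (s : Fin n → SignType) (e : SignType) :
    IsRiordanPrefix (Fin.snoc s e : Fin (n + 1) → SignType) ↔
      IsRiordanPrefix s ∧ 0 ≤ pathHeight s n + e ∧ (e = 0 → pathHeight s n ≠ 0) := by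
  constructor
  · rintro ⟨h1, h2⟩
    refine ⟨⟨fun m hm => ?_, fun j hj => ?_⟩, ?_, fun he => ?_⟩
    · rw [← pathHeight_snoc s e hm]; exact h1 m (by omega)
    · rw [← pathHeight_snoc s e j.2.le]
      exact h2 j.castSucc (by simpa using hj)
    · rw [← pathHeight_snoc_last]; exact h1 _ le_rfl
    · rw [← pathHeight_snoc s e le_rfl]
      exact h2 (Fin.last n) (by simpa using he)
  · rintro ⟨⟨h1, h2⟩, h3, h4⟩
    refine ⟨fun m hm => ?_, fun j hj => ?_⟩
    · rcases Nat.lt_or_ge n m with hlt | hle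
      · obtain rfl : m = n + 1 := by omega
        rw [pathHeight_snoc_last]; exact h3
      · rw [pathHeight_snoc s e hle]; exact h1 m hle
    · induction j using Fin.lastCases with
      | last =>
        rw [Fin.val_last, pathHeight_snoc s e le_rfl]
        exact h4 (by simpa using hj)
      | cast j =>
        rw [Fin.val_castSucc, pathHeight_snoc s e j.2.le]
        exact h2 j (by simpa using hj)

theorem prefixCount_of_neg {n : ℕ} {h : ℤ} (hh : h < 0) : prefixCount n h = 0 := by
  classical
  rw [prefixCount, Finset.card_eq_zero, Finset.filter_eq_empty_iff]
  rintro s - ⟨⟨h1, -⟩, h2⟩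
  have := h1 n le_rfl
  omega

/-- Removal of the last step.  A horizontal last step is not allowed at height `0`. -/
theorem prefixCount_succ {n : ℕ} {h : ℤ} (hh : 0 ≤ h) :
    prefixCount (n + 1) h =
      prefixCount n (h - 1) + (if h = 0 then 0 else prefixCount n h) + prefixCount n (h + 1) := by
  classical
  -- The paths whose last step is `e`.
  have key : prefixCount (n + 1) h = ∑ e : SignType,
      (Finset.univ.filter fun s : Fin n → SignType =>
        IsRiordanPrefix s ∧ (e = 0 → pathHeight s n ≠ 0) ∧ pathHeight s n + e = h).card := by
    rw [prefixCount, Finset.card_filter,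
      ← (Fin.snocEquiv fun _ : Fin (n + 1) => SignType).sum_comp, Fintype.sum_prod_type]
    refine Finset.sum_congr rfl fun e _ => ?_
    rw [Finset.card_filter]
    refine Finset.sum_congr rfl fun s _ => ?_
    congr 1
    apply propext
    change IsRiordanPrefix (Fin.snoc s e : Fin (n + 1) → SignType) ∧
      pathHeight (Fin.snoc s e : Fin (n + 1) → SignType) (n + 1) = h ↔ _
    rw [isRiordanPrefix_snoc, pathHeight_snoc_last]
    constructor
    · rintro ⟨⟨h1, -, h3⟩, h4⟩; exact ⟨h1, h3, h4⟩
    · rintro ⟨h1, h3, h4⟩; exact ⟨⟨h1, h4 ▸ hh, h3⟩, h4⟩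
  have hsum : ∀ F : SignType → ℕ, ∑ e, F e = F 1 + F 0 + F (-1) := by
    intro F
    rw [show (Finset.univ : Finset SignType) = {1, 0, -1} by decide, Finset.sum_insert (by decide),
      Finset.sum_insert (by decide), Finset.sum_singleton]
    ring
  rw [key, hsum]
  congr 1
  · congr 1
    · rw [prefixCount]
      congr 1
      refine Finset.filter_congr fun s _ => and_congr_right fun _ => ?_
      simp only [one_ne_zero, false_imp_iff, true_and, SignType.coe_one]
      omega
    · split_ifs with h0
      · rw [Finset.card_eq_zero, Finset.filter_eq_empty_iff]
        rintro s - ⟨-, h1, h2⟩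
        simp only [SignType.coe_zero] at h2
        exact h1 rfl (by omega)
      · rw [prefixCount]
        congr 1
        refine Finset.filter_congr fun s _ => and_congr_right fun _ => ?_
        simp only [forall_const, SignType.coe_zero]
        omega
  · rw [prefixCount]
    congr 1
    refine Finset.filter_congr fun s _ => and_congr_right fun _ => ?_
    have h1 : ((-1 : SignType) = 0) = False := by simp
    simp only [h1, false_imp_iff, true_and, SignType.coe_neg_one]
    omega

/-- The reflection principle: as `reflected n` is antisymmetric under `h ↦ -1 - h`, it satisfies
at height `0` the recurrence of the paths with no horizontal step there. -/
theorem prefixCount_eq (n : ℕ) {h : ℤ} (hh : 0 ≤ h) : (prefixCount n h : ℤ) = reflected n h := by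
  induction n generalizing h with
  | zero =>
    classical
    have : ∀ s : Fin 0 → SignType, IsRiordanPrefix s := fun s =>
      ⟨fun m _ => by simp [pathHeight], fun j => j.elim0⟩
    simp only [prefixCount, this, true_and, pathHeight, reflected]
    by_cases h0 : h = 0
    · simp [h0]
    · rw [if_neg h0, if_neg (by omega)]
      simp [Ne.symm h0]
  | succ n ih =>
    rw [prefixCount_succ hh, reflected]
    push_cast
    rw [ih (by omega : 0 ≤ h + 1)]
    by_cases h0 : h = 0
    · have := reflected_neg n 0
      subst h0
      rw [prefixCount_of_neg (by norm_num)]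
      simp only [sub_zero, zero_sub] at this ⊢
      rw [this]
      simp
    · rw [if_neg h0, ih hh, ih (by omega)]

theorem riordan_eq (n : ℕ) : (riordan n : ℤ) = reflected n 0 := by
  classical
  rw [← prefixCount_eq n le_rfl, riordan, Nat.card_eq_fintype_card, Fintype.card_subtype,
    prefixCount]
  congr 2
  refine Finset.filter_congr fun s _ => ?_
  rw [IsRiordanPath, IsRiordanPrefix, and_comm]

end Riordan

/-! ### The identities -/

section Identities

open Polynomial

theorem alpha_middle_zero (ℓ : ℕ) : alpha (2 * ℓ) (ℓ : ℤ) 0 = (catalan ℓ : ℂ) := by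
  rw [alpha_eq_coeff (by omega) (by omega)]
  rcases ℓ with _ | ℓ
  · simp
  have h1 : ((1 - X) * ((1 + X) ^ (2 * (ℓ + 1) - 2 * 0) * (1 + X + X ^ 2) ^ 0) : ℂ[X]) =
      (1 + X) ^ (2 * (ℓ + 1)) - (1 + X) ^ (2 * (ℓ + 1)) * X := by
    rw [mul_zero, Nat.sub_zero]; ring
  rw [h1, coeff_sub, coeff_mul_X, coeff_one_add_X_pow, coeff_one_add_X_pow]
  have h2 := succ_mul_catalan_eq_centralBinom (ℓ + 1)
  have h3 := Nat.choose_succ_right_eq (2 * (ℓ + 1)) ℓ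
  rw [Nat.centralBinom] at h2
  rw [show 2 * (ℓ + 1) - ℓ = ℓ + 2 by omega] at h3
  have h2' : ((ℓ : ℂ) + 1 + 1) * catalan (ℓ + 1) = ((2 * (ℓ + 1)).choose (ℓ + 1) : ℂ) := by
    exact_mod_cast h2
  have h3' : ((2 * (ℓ + 1)).choose (ℓ + 1) : ℂ) * (ℓ + 1) =
      ((2 * (ℓ + 1)).choose ℓ : ℂ) * (ℓ + 2) := by
    exact_mod_cast h3
  have h4 : (ℓ : ℂ) + 2 ≠ 0 := by exact_mod_cast (by omega : ℓ + 2 ≠ 0)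
  apply mul_left_cancel₀ h4
  linear_combination (-1 : ℂ) * h2' + h3'

theorem alpha_middle_middle (ℓ : ℕ) : alpha (2 * ℓ) (ℓ : ℤ) ℓ = (riordan ℓ : ℂ) := by
  rw [alpha_eq_coeff le_rfl le_rfl, Nat.sub_self, pow_zero, one_mul, coeff_trinomial, sub_self,
    ← riordan_eq, Int.cast_natCast]

theorem alpha_of_neg (n : ℕ) {k : ℤ} (hk : k < 0) (i : ℕ) : alpha n k i = 0 := by
  rw [alpha, dif_neg]
  omega

/-- Expand `(1 + X) ^ (2 * (ℓ - i)) = (X + (1 + X + X ^ 2)) ^ (ℓ - i)` in the generating function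
of the left-hand side. -/
theorem alpha_eq_sum (ℓ k i : ℕ) (hk : k ≤ ℓ) (hi : i ≤ ℓ) :
    alpha (2 * ℓ) (k : ℤ) i =
      ∑ t ∈ Finset.range (ℓ - i + 1),
        ((ℓ - i).choose t : ℂ) * alpha (2 * ℓ - 2 * t) ((k : ℤ) - (t : ℤ)) (ℓ - t) := by
  have hsq : ((1 + X) ^ (2 * ℓ - 2 * i) : ℂ[X]) = (X + (1 + X + X ^ 2)) ^ (ℓ - i) := by
    rw [show 2 * ℓ - 2 * i = 2 * (ℓ - i) by omega, pow_mul]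
    ring
  rw [alpha_eq_coeff (by omega) (by omega), hsq, add_pow X, Finset.sum_mul, Finset.mul_sum,
    finsetSum_coeff]
  refine Finset.sum_congr rfl fun t ht => ?_
  have hti : t ≤ ℓ - i := by simpa [Nat.lt_succ_iff] using ht
  have e : ((1 - X) * (X ^ t * (1 + X + X ^ 2) ^ (ℓ - i - t) * ((ℓ - i).choose t : ℂ[X]) *
      (1 + X + X ^ 2) ^ i) : ℂ[X]) =
      C ((ℓ - i).choose t : ℂ) * ((1 - X) * (1 + X + X ^ 2) ^ (ℓ - t) * X ^ t) := by
    rw [show ℓ - t = (ℓ - i - t) + i by omega, pow_add, C_eq_natCast]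
    ring
  rw [e, coeff_C_mul, coeff_mul_X_pow']
  congr 1
  split_ifs with htk
  · rw [← Nat.cast_sub htk, alpha_eq_coeff (by omega) (by omega),
      show 2 * ℓ - 2 * t - 2 * (ℓ - t) = 0 by omega, pow_zero, one_mul]
  · rw [alpha_of_neg _ (by omega)]

end Identities

end TwoRowImmanant

theorem mainTheorem8 (ℓ : ℕ) :
    (∀ k i : ℕ, k ≤ ℓ → i ≤ ℓ →
      TwoRowImmanant.alpha (2 * ℓ) (k : ℤ) i =
        ∑ t ∈ Finset.range (ℓ - i + 1),
          ((ℓ - i).choose t : ℂ) *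
            TwoRowImmanant.alpha (2 * ℓ - 2 * t) ((k : ℤ) - (t : ℤ)) (ℓ - t)) ∧
    TwoRowImmanant.alpha (2 * ℓ) (ℓ : ℤ) 0 = (catalan ℓ : ℂ) ∧
    TwoRowImmanant.alpha (2 * ℓ) (ℓ : ℤ) ℓ = (TwoRowImmanant.riordan ℓ : ℂ) ∧
    catalan ℓ =
      ∑ t ∈ Finset.range (ℓ + 1), ℓ.choose t * TwoRowImmanant.riordan (ℓ - t) := by
  refine ⟨fun k i hk hi => TwoRowImmanant.alpha_eq_sum ℓ k i hk hi,
    TwoRowImmanant.alpha_middle_zero ℓ, TwoRowImmanant.alpha_middle_middle ℓ, ?_⟩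
  have h := TwoRowImmanant.alpha_eq_sum ℓ ℓ 0 le_rfl (Nat.zero_le ℓ)
  rw [TwoRowImmanant.alpha_middle_zero, Nat.sub_zero] at h
  apply Nat.cast_injective (R := ℂ)
  rw [h]
  push_cast
  refine Finset.sum_congr rfl fun t ht => ?_
  have htl : t ≤ ℓ := by simpa [Nat.lt_succ_iff] using ht
  rw [← Nat.cast_sub htl, ← Nat.mul_sub, TwoRowImmanant.alpha_middle_middle]
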